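/- For $\Omega\subset\mathbb R$ and $\alpha\ge 0$, let $C^\alpha(\Omega)$ be the space of functions $u$ on $\Omega$ that are continuously differentiable up to order $\lfloor\alpha\rfloor$, with $u$ and all these derivatives bounded on $\Omega$, and whose derivative of order $\lfloor\alpha\rfloor$ satisfies the Hölder condition with index $\alpha-\lfloor\alpha\rfloor$, that is, $|u^{(\lfloor\alpha\rfloor)}(x)-u^{(\lfloor\alpha\rfloor)}(y)|\le C|x-y|^{\alpha-\lfloor\alpha\rfloor}$ for some constant $C$ and all distinct $x,y\in\Omega$. For $0<s<1$ let $$(-\Delta)^s u(x):=c_s\,\mathrm{P.V.}\!\int_{\mathbb R}\frac{u(x)-u(y)}{|x-y|^{1+2s}}\,dy,\qquad c_s:=\frac{s\,4^s\,\Gamma(1/2+s)}{\sqrt\pi\,\Gamma(1-s)},$$ where the principal value is the limit as $\delta\downarrow0$ of the integrals over $\{|x-y|>\delta\}$. **Theorem 1.2.** Let $0<s<1$, $0<\beta<1$ and $L>0$. (i) If $2s\le 1-\beta$, then there exists a $2L$-periodic function $u\in C^{2s/(1-\beta)}(\mathbb R)$ such that, for some $f\in C^\beta(\mathbb R)$,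 the principal value $(-\Delta)^su(x)$ exists and equals $f(u(x))$ for every $x\in\mathbb R$, and such that $u\notin C^{2s/(1-\beta)+\varepsilon}([-\rho,\rho])$ for all $\varepsilon>0$ and $\rho>0$. (ii) If $2s>1-\beta$, then there exists a $2L$-periodic function $u\in C^{2s+\beta}(\mathbb R)$ such that, for some $f\in C^\beta(\mathbb R)$, the principal value $(-\Delta)^su(x)$ exists and equals $f(u(x))$ for every $x\in\mathbb R$, and such that $u\notin C^{2s+\beta+\varepsilon}([-\rho,\rho])$ for all $\varepsilon>0$ and $\rho>0$. -/

import Mathlib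

open Set Filter Topology MeasureTheory

/-- `IsHolder α Ω u` says that `u` belongs to `C^α(Ω)`, for `Ω ⊆ ℝ` and `α ≥ 0`: on `Ω`, the
function `u` is continuously differentiable up to order `⌊α⌋`, its derivatives up to order `⌊α⌋`
(including `u` itself) are bounded, and the derivative of order `⌊α⌋` satisfies the Hölder
condition with index `α - ⌊α⌋`. Derivatives are taken within `Ω`, hence one-sided at the
endpoints of a compact interval. -/
def IsHolder (α : ℝ) (Ω : Set ℝ) (u : ℝ → ℝ) : Prop :=
  ContDiffOn ℝ (⌊α⌋₊ : ℕ) u Ω ∧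
  (∀ k : ℕ, k ≤ ⌊α⌋₊ → ∃ C : ℝ, ∀ x ∈ Ω, |iteratedDerivWithin k u Ω x| ≤ C) ∧
  ∃ C : NNReal, HolderOnWith C (α - ⌊α⌋₊).toNNReal (iteratedDerivWithin ⌊α⌋₊ u Ω) Ω

/-- The normalizing constant `c_s = s 4^s Γ(1/2 + s) / (√π Γ(1 - s))`. -/
noncomputable def fracLaplacianConst (s : ℝ) : ℝ :=
  s * (4 : ℝ) ^ s * Real.Gamma (1 / 2 + s) / (Real.sqrt Real.pi * Real.Gamma (1 - s))

/-- `HasFracLaplacian s u x v` says that the principal value integral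
`c_s P.V. ∫ (u x - u y) / |x - y| ^ (1 + 2 s) dy` defining `(-Δ)^s u(x)` exists and equals `v`:
the integrand is integrable on `{y | δ < |x - y|}` for every `δ > 0`, and `c_s` times the
truncated integrals tend to `v` as `δ → 0⁺`. -/
def HasFracLaplacian (s : ℝ) (u : ℝ → ℝ) (x v : ℝ) : Prop :=
  (∀ δ : ℝ, 0 < δ →
    IntegrableOn (fun y : ℝ => (u x - u y) / |x - y| ^ (1 + 2 * s)) {y : ℝ | δ < |x - y|}) ∧
  Tendsto
    (fun δ : ℝ => fracLaplacianConst s *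
      ∫ y in {y : ℝ | δ < |x - y|}, (u x - u y) / |x - y| ^ (1 + 2 * s))
    (𝓝[>] 0) (𝓝 v)

/-!
For `ω = π / L` put `u_p(x) = ∑ (2 i + 1) ^ (-1 - p) sin ((2 i + 1) ω x)`, so that `(-Δ)^s` maps
`u_{θ + 2 s}` to a multiple of `u_θ`. Writing `n ^ (-p)` as a Gamma integral and summing the series
under it gives `u_p(x) = F_p(sin (ω x))`, where `F_p(S)` is up to a constant the Mellin transform
at `p` of `arctan (S / sinh t)` and increases strictly with `S`. Hence `u_θ` is a function of
`u_γ`, `γ = θ + 2 s`, and this function is `β`-Hölder as soon as the increments of `F_θ` are bounded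
by the `β`-th powers of those of `F_γ`. An increment of `F_p` over `[S', S]` is at most of order
`(S - S') ^ p` for `p < 1` and at least of order `S - S'`, which leads to `θ = β`; splitting the
Mellin integral at the `1 / γ`-th power of the increment of `F_γ` leads to `θ = β γ`.

To land exactly in `C^γ` also for integer `γ`, superpose the functions `u_{γ + η_j}` with `η_j`
decreasing to `0` and summable weights. The Fourier coefficients are nonnegative, so a Hölder
condition of order `γ + δ` at `0` would bound every dyadic block of them, of size `N ^ (-γ - η_j)`,
by `N ^ (-γ - δ)`.
-/

section SineSeries

open Real

variable {ι : Type*} {a κ : ι → ℝ} {φ : ℝ}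

/-- The sine series with amplitudes `a`, frequencies `κ` and common phase `φ`. The phase makes the
family closed under differentiation, which shifts `φ` by `π / 2`. -/
noncomputable def sineSeries (a κ : ι → ℝ) (φ x : ℝ) : ℝ :=
  ∑' i, a i * sin (κ i * x + φ)

theorem norm_mul_sin_le (c x : ℝ) : ‖c * sin x‖ ≤ |c| := by
  rw [norm_mul, norm_eq_abs, norm_eq_abs]
  exact mul_le_of_le_one_right (abs_nonneg c) (abs_sin_le_one x)

theorem summable_mul_sin (ha : Summable a) (f : ι → ℝ) : Summable fun i => a i * sin (f i) :=
  .of_norm_bounded ha.abs fun i => norm_mul_sin_le (a i) (f i)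

theorem abs_sineSeries_le (ha : Summable a) (x : ℝ) : |sineSeries a κ φ x| ≤ ∑' i, |a i| :=
  tsum_of_norm_bounded ha.abs.hasSum fun i => norm_mul_sin_le (a i) _

theorem continuous_sineSeries (ha : Summable a) : Continuous (sineSeries a κ φ) :=
  continuous_tsum (fun i => by fun_prop) ha.abs fun i _ => norm_mul_sin_le (a i) _

theorem hasDerivAt_sineSeries (ha : Summable a) (haκ : Summable fun i => a i * κ i) (x : ℝ) :
    HasDerivAt (sineSeries a κ φ) (sineSeries (fun i => a i * κ i) κ (φ + π / 2) x) x := by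
  refine hasDerivAt_tsum (g := fun i y => a i * sin (κ i * y + φ))
    (g' := fun i y => a i * κ i * sin (κ i * y + (φ + π / 2))) haκ.abs (fun i y => ?_)
    (fun i y => norm_mul_sin_le (a i * κ i) _) (summable_mul_sin ha fun i => κ i * 0 + φ) x
  have hlin : HasDerivAt (fun y => κ i * y + φ) (κ i) y := by
    simpa using ((hasDerivAt_id y).const_mul (κ i)).add_const φ
  refine (hlin.sin.const_mul (a i)).congr_deriv ?_
  rw [← add_assoc, sin_add_pi_div_two]
  ring

theorem iteratedDeriv_sineSeries {n : ℕ} (hs : ∀ k ≤ n, Summable fun i => a i * κ i ^ k) :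
    iteratedDeriv n (sineSeries a κ φ)
      = sineSeries (fun i => a i * κ i ^ n) κ (φ + n * (π / 2)) := by
  induction n with
  | zero => simp [iteratedDeriv_zero]
  | succ n ih =>
    rw [iteratedDeriv_succ, ih fun k hk => hs k (hk.trans n.le_succ)]
    have hn : Summable fun i => a i * κ i ^ n * κ i := by
      simpa [pow_succ, mul_assoc] using hs _ le_rfl
    funext x
    rw [(hasDerivAt_sineSeries (hs n n.le_succ) hn x).deriv]
    simp only [pow_succ, mul_assoc, Nat.cast_succ, add_mul, one_mul, add_assoc]

theorem contDiff_sineSeries {n : ℕ} (hs : ∀ k ≤ n, Summable fun i => a i * κ i ^ k) :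
    ContDiff ℝ n (sineSeries a κ φ) := by
  have hs' {k m : ℕ} (hk : k ≤ n) (hm : m ≤ k) : Summable fun i => a i * κ i ^ m :=
    hs m (hm.trans hk)
  refine contDiff_iff_iteratedDeriv (n := (n : ℕ∞)).2 ⟨fun k hk => ?_, fun k hk => ?_⟩
  · have hk : k ≤ n := by exact_mod_cast hk
    rw [iteratedDeriv_sineSeries fun m => hs' hk]
    exact continuous_sineSeries (hs k hk)
  · have hk : k < n := by exact_mod_cast hk
    rw [iteratedDeriv_sineSeries fun m => hs' hk.le]
    have hk' : Summable fun i => a i * κ i ^ k * κ i := by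
      simpa [pow_succ, mul_assoc] using hs (k + 1) hk
    exact fun x => (hasDerivAt_sineSeries (hs k hk.le) hk' x).differentiableAt

theorem abs_sin_sub_sin_le_rpow {θ : ℝ} (hθ0 : 0 ≤ θ) (hθ1 : θ ≤ 1) (x y : ℝ) :
    |sin x - sin y| ≤ 2 * |x - y| ^ θ := by
  rcases le_total |x - y| 1 with h | h
  · calc |sin x - sin y| ≤ |x - y| := abs_sin_sub_sin_le x y
      _ ≤ |x - y| ^ θ := self_le_rpow_of_le_one (abs_nonneg _) h hθ1
      _ ≤ 2 * |x - y| ^ θ := by linarith [rpow_nonneg (abs_nonneg (x - y)) θ]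
  · calc |sin x - sin y| ≤ |sin x| + |sin y| := abs_sub _ _
      _ ≤ 2 * 1 := by linarith [abs_sin_le_one x, abs_sin_le_one y]
      _ ≤ 2 * |x - y| ^ θ := by gcongr; exact one_le_rpow h hθ0

theorem abs_sineSeries_sub_le (hκ : ∀ i, 0 ≤ κ i) (ha : Summable a) {θ : ℝ} (hθ0 : 0 ≤ θ)
    (hθ1 : θ ≤ 1) (haκ : Summable fun i => a i * κ i ^ θ) (x y : ℝ) :
    |sineSeries a κ φ x - sineSeries a κ φ y| ≤ 2 * (∑' i, |a i * κ i ^ θ|) * |x - y| ^ θ := by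
  rw [sineSeries, sineSeries, ← (summable_mul_sin ha _).tsum_sub (summable_mul_sin ha _),
    ← norm_eq_abs]
  refine tsum_of_norm_bounded ((haκ.abs.hasSum.mul_left 2).mul_right _) fun i => ?_
  rw [← mul_sub, norm_mul, norm_eq_abs, norm_eq_abs]
  calc |a i| * |sin (κ i * x + φ) - sin (κ i * y + φ)|
      ≤ |a i| * (2 * |(κ i * x + φ) - (κ i * y + φ)| ^ θ) := by
        gcongr; exact abs_sin_sub_sin_le_rpow hθ0 hθ1 _ _
    _ = 2 * |a i * κ i ^ θ| * |x - y| ^ θ := by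
        rw [add_sub_add_right_eq_sub, ← mul_sub, abs_mul, abs_of_nonneg (hκ i),
          mul_rpow (hκ i) (abs_nonneg _), abs_mul, abs_of_nonneg (rpow_nonneg (hκ i) θ)]
        ring

theorem rpow_le_one_add_rpow {x p q : ℝ} (hx : 0 ≤ x) (hp : 0 ≤ p) (hpq : p ≤ q) :
    x ^ p ≤ 1 + x ^ q := by
  rcases le_total x 1 with h | h
  · linarith [rpow_le_one hx h hp, rpow_nonneg hx q]
  · linarith [rpow_le_rpow_of_exponent_le h hpq]

theorem summable_mul_rpow_of_le (hκ : ∀ i, 0 ≤ κ i) (ha : Summable a) {r γ : ℝ}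
    (haκ : Summable fun i => a i * κ i ^ γ) (hr : 0 ≤ r) (hrγ : r ≤ γ) :
    Summable fun i => a i * κ i ^ r := by
  refine .of_norm_bounded (ha.abs.add haκ.abs) fun i => ?_
  rw [norm_eq_abs, abs_mul, abs_mul, abs_of_nonneg (rpow_nonneg (hκ i) r),
    abs_of_nonneg (rpow_nonneg (hκ i) γ), ← mul_one_add]
  exact mul_le_mul_of_nonneg_left (rpow_le_one_add_rpow (hκ i) hr hrγ) (abs_nonneg _)

theorem summable_mul_pow_of_le (hκ : ∀ i, 0 ≤ κ i) (ha : Summable a) {γ : ℝ}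
    (haκ : Summable fun i => a i * κ i ^ γ) {k : ℕ} (hk : (k : ℝ) ≤ γ) :
    Summable fun i => a i * κ i ^ k := by
  simpa only [rpow_natCast] using summable_mul_rpow_of_le hκ ha haκ k.cast_nonneg hk

end SineSeries

section Holder

theorem holderOnWith_of_abs_sub_le {C r : ℝ} (hr : 0 ≤ r) {Ω : Set ℝ} {f : ℝ → ℝ}
    (h : ∀ x ∈ Ω, ∀ y ∈ Ω, |f x - f y| ≤ C * |x - y| ^ r) :
    HolderOnWith C.toNNReal r.toNNReal f Ω := by
  intro x hx y hy
  have h' : |f x - f y| ≤ C.toNNReal * |x - y| ^ r :=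
    (h x hx y hy).trans (by gcongr; exact Real.le_coe_toNNReal C)
  rw [edist_dist, edist_dist, Real.dist_eq, Real.dist_eq, Real.coe_toNNReal r hr,
    ENNReal.ofReal_rpow_of_nonneg (abs_nonneg _) hr, ← ENNReal.ofReal_coe_nnreal,
    ← ENNReal.ofReal_mul (by positivity)]
  exact ENNReal.ofReal_le_ofReal h'

theorem abs_sub_le_of_holderOnWith {C : NNReal} {r : ℝ} (hr : 0 ≤ r) {Ω : Set ℝ} {f : ℝ → ℝ}
    (h : HolderOnWith C r.toNNReal f Ω) {x y : ℝ} (hx : x ∈ Ω) (hy : y ∈ Ω) :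
    |f x - f y| ≤ C * |x - y| ^ r := by
  simpa [Real.dist_eq, Real.coe_toNNReal r hr] using h.dist_le hx hy

theorem isHolder_sineSeries {ι : Type*} {a κ : ι → ℝ} {φ γ : ℝ} (hκ : ∀ i, 0 ≤ κ i)
    (ha : Summable a) (hγ : 0 ≤ γ) (haκ : Summable fun i => a i * κ i ^ γ) :
    IsHolder γ univ (sineSeries a κ φ) := by
  have hfl : (⌊γ⌋₊ : ℝ) ≤ γ := Nat.floor_le hγ
  have hs (k : ℕ) (hk : k ≤ ⌊γ⌋₊) : Summable fun i => a i * κ i ^ k :=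
    summable_mul_pow_of_le hκ ha haκ ((Nat.cast_le.2 hk).trans hfl)
  have hfrac : Summable fun i => a i * κ i ^ ⌊γ⌋₊ * κ i ^ (γ - ⌊γ⌋₊) := by
    convert haκ using 2 with i
    rw [mul_assoc, ← Real.rpow_natCast, ← Real.rpow_add_of_nonneg (hκ i) (Nat.cast_nonneg _)
      (sub_nonneg.2 hfl), add_sub_cancel]
  refine ⟨(contDiff_sineSeries hs).contDiffOn, fun k hk => ?_, ?_⟩
  · rw [iteratedDerivWithin_univ, iteratedDeriv_sineSeries fun m hm => hs m (hm.trans hk)]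
    exact ⟨_, fun x _ => abs_sineSeries_le (hs k hk) x⟩
  · rw [iteratedDerivWithin_univ, iteratedDeriv_sineSeries hs]
    exact ⟨_, holderOnWith_of_abs_sub_le (sub_nonneg.2 hfl) fun x _ y _ =>
      abs_sineSeries_sub_le hκ (hs _ le_rfl) (sub_nonneg.2 hfl)
        (by linarith [Nat.lt_floor_add_one γ]) hfrac x y⟩

theorem IsHolder.exists_abs_iteratedDeriv_sub_le {γ ε ρ : ℝ} {u : ℝ → ℝ} (hγ : 0 ≤ γ) (hε : 0 < ε)
    (hρ : 0 < ρ) (hu : ContDiff ℝ ⌊γ⌋₊ u) (h : IsHolder (γ + ε) (Icc (-ρ) ρ) u) :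
    ∃ δ C : ℝ, 0 < δ ∧ ∀ x ∈ Icc 0 ρ,
      |iteratedDeriv ⌊γ⌋₊ u x - iteratedDeriv ⌊γ⌋₊ u 0| ≤ C * x ^ (γ - ⌊γ⌋₊ + δ) := by
  have hU : UniqueDiffOn ℝ (Icc (-ρ) ρ) := uniqueDiffOn_Icc (by linarith)
  have h0 : (0 : ℝ) ∈ Icc (-ρ) ρ := ⟨by linarith, hρ.le⟩
  have hsub : Icc 0 ρ ⊆ Icc (-ρ) ρ := Icc_subset_Icc_left (by linarith)
  have hwithin : ∀ x ∈ Icc (-ρ) ρ,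
      iteratedDerivWithin ⌊γ⌋₊ u (Icc (-ρ) ρ) x = iteratedDeriv ⌊γ⌋₊ u x := fun x hx =>
    iteratedDerivWithin_eq_iteratedDeriv hU hu.contDiffAt hx
  obtain ⟨hdiff, hbdd, C, hC⟩ := h
  have hle : ⌊γ⌋₊ ≤ ⌊γ + ε⌋₊ := Nat.floor_mono (by linarith)
  rcases hle.eq_or_lt with heq | hlt
  · rw [← heq] at hC
    refine ⟨ε, C, hε, fun x hx => ?_⟩
    have hr : 0 ≤ γ + ε - ⌊γ⌋₊ := by linarith [Nat.floor_le hγ]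
    have := abs_sub_le_of_holderOnWith hr hC (hsub hx) h0
    rwa [hwithin x (hsub hx), hwithin 0 h0, sub_zero, abs_of_nonneg hx.1,
      add_sub_right_comm] at this
  -- A bounded derivative of order `⌊γ⌋ + 1` gives a Lipschitz condition, and `1 > γ - ⌊γ⌋`.
  · obtain ⟨B, hB⟩ := hbdd (⌊γ⌋₊ + 1) hlt
    refine ⟨1 - (γ - ⌊γ⌋₊), B, by linarith [Nat.lt_floor_add_one γ], fun x hx => ?_⟩
    have hd : DifferentiableOn ℝ (iteratedDerivWithin ⌊γ⌋₊ u (Icc (-ρ) ρ)) (Icc (-ρ) ρ) :=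
      hdiff.differentiableOn_iteratedDerivWithin (by exact_mod_cast hlt) hU
    have := (convex_Icc (-ρ) ρ).norm_image_sub_le_of_norm_derivWithin_le hd (C := B)
      (fun y hy => by rw [← iteratedDerivWithin_succ]; exact hB y hy) h0 (hsub hx)
    rw [hwithin x (hsub hx), hwithin 0 h0, sub_zero, Real.norm_eq_abs, Real.norm_eq_abs,
      abs_of_nonneg hx.1] at this
    rwa [add_sub_cancel, Real.rpow_one]

end Holder

section FracLaplacian

theorem integrable_comp_abs_of_integrableOn_Ioi {f : ℝ → ℝ} (hf : IntegrableOn f (Ioi 0)) :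
    Integrable fun t => f |t| := by
  have hpos : IntegrableOn (fun t => f |t|) (Ioi 0) :=
    hf.congr_fun (fun t ht => by simp only [abs_of_pos (mem_Ioi.1 ht)]) measurableSet_Ioi
  have hneg : IntegrableOn (fun t => f |t|) (Iic 0) := by
    rw [integrableOn_Iic_iff_integrableOn_Iio]
    have h := (Measure.measurePreserving_neg (volume : Measure ℝ)).integrableOn_comp_preimage
      (Homeomorph.neg ℝ).measurableEmbedding (f := fun t => f |t|) (s := Ioi 0)
    simpa [Function.comp_def] using h.2 hpos
  simpa using hneg.union hpos

theorem measurableSet_lt_abs (δ : ℝ) : MeasurableSet {t : ℝ | δ < |t|} :=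
  measurableSet_lt measurable_const measurable_id.abs

theorem integrableOn_inv_abs_rpow {p δ : ℝ} (hp : 1 < p) (hδ : 0 < δ) :
    IntegrableOn (fun t : ℝ => (|t| ^ p)⁻¹) {t | δ < |t|} := by
  have htail : IntegrableOn (fun t : ℝ => (t ^ p)⁻¹) (Ioi δ) :=
    (integrableOn_Ioi_rpow_of_lt (neg_lt_neg hp) hδ).congr_fun
      (fun t ht => Real.rpow_neg (hδ.trans ht).le p) measurableSet_Ioi
  have hind : IntegrableOn ((Ioi δ).indicator fun t : ℝ => (t ^ p)⁻¹) (Ioi 0) :=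
    ((integrable_indicator_iff measurableSet_Ioi).2 htail).integrableOn
  rw [← integrable_indicator_iff (measurableSet_lt_abs δ)]
  refine (integrable_comp_abs_of_integrableOn_Ioi hind).congr (.of_forall fun t => ?_)
  by_cases ht : δ < |t| <;> simp [indicator, ht]

theorem integrableOn_sub_div_abs_rpow {p δ : ℝ} (hp : 1 < p) (hδ : 0 < δ) {u : ℝ → ℝ}
    (hu : Measurable u) {M : ℝ} (hM : ∀ y, |u y| ≤ M) (x : ℝ) :
    IntegrableOn (fun t => (u x - u (x - t)) / |t| ^ p) {t | δ < |t|} := by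
  have hmeas : Measurable fun t => (u x - u (x - t)) / |t| ^ p := by fun_prop
  refine ((integrableOn_inv_abs_rpow hp hδ).const_mul (2 * M)).mono' hmeas.aestronglyMeasurable
    (.of_forall fun t => ?_)
  rw [norm_div, Real.norm_eq_abs, Real.norm_of_nonneg (by positivity), div_eq_mul_inv]
  gcongr
  linarith [abs_sub (u x) (u (x - t)), hM x, hM (x - t)]

theorem integrableOn_comp_sub_left_iff {f : ℝ → ℝ} (δ x : ℝ) :
    IntegrableOn (fun y => f (x - y)) {y | δ < |x - y|} ↔ IntegrableOn f {t | δ < |t|} :=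
  (volume.measurePreserving_sub_left x).integrableOn_comp_preimage (f := f) (s := {t | δ < |t|})
    (Homeomorph.subLeft x).measurableEmbedding

theorem setIntegral_comp_sub_left (f : ℝ → ℝ) (δ x : ℝ) :
    ∫ y in {y | δ < |x - y|}, f (x - y) = ∫ t in {t | δ < |t|}, f t :=
  (volume.measurePreserving_sub_left x).setIntegral_preimage_emb
    (Homeomorph.subLeft x).measurableEmbedding f {t | δ < |t|}

theorem setIntegral_lt_abs_eq_half {f : ℝ → ℝ} {δ : ℝ} (hf : IntegrableOn f {t | δ < |t|}) :
    ∫ t in {t | δ < |t|}, f t = 1 / 2 * ∫ t in {t | δ < |t|}, (f t + f (-t)) := by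
  have hint := integrableOn_comp_sub_left_iff (f := f) δ 0
  have hval := setIntegral_comp_sub_left f δ 0
  simp only [zero_sub, abs_neg] at hint hval
  rw [integral_add hf (hint.2 hf), hval]
  ring

theorem aecover_lt_abs : AECover volume (𝓝[>] (0 : ℝ)) fun δ => {t : ℝ | δ < |t|} where
  ae_eventually_mem := by
    filter_upwards [ae_iff.2 (by simp : volume {t : ℝ | ¬t ≠ 0} = 0)] with t ht
    exact nhdsWithin_le_nhds (eventually_lt_nhds (abs_pos.2 ht))
  measurableSet := measurableSet_lt_abs

/-- The symmetric second difference at `x`, whose integral against `|t| ^ (-1 - 2 s)` turns the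
principal value defining `(-Δ)^s u(x)` into an absolutely convergent integral. -/
def secondDifference (u : ℝ → ℝ) (x t : ℝ) : ℝ := 2 * u x - u (x - t) - u (x + t)

theorem hasFracLaplacian_of_integrable {s x M : ℝ} (hs : 0 < s) {u : ℝ → ℝ} (hu : Measurable u)
    (hM : ∀ y, |u y| ≤ M) (hint : Integrable fun t => secondDifference u x t / |t| ^ (1 + 2 * s)) :
    HasFracLaplacian s u x (fracLaplacianConst s *
      (1 / 2 * ∫ t, secondDifference u x t / |t| ^ (1 + 2 * s))) := by
  have hp : 1 < 1 + 2 * s := by linarith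
  set f : ℝ → ℝ := fun t => (u x - u (x - t)) / |t| ^ (1 + 2 * s) with hf
  have hf_comp : (fun y => (u x - u y) / |x - y| ^ (1 + 2 * s)) = fun y => f (x - y) := by
    simp only [hf, sub_sub_cancel]
  have hf_symm (t : ℝ) : f t + f (-t) = secondDifference u x t / |t| ^ (1 + 2 * s) := by
    simp only [hf, secondDifference, abs_neg, sub_neg_eq_add]
    ring
  have hf_int {δ : ℝ} (hδ : 0 < δ) : IntegrableOn f {t | δ < |t|} :=
    integrableOn_sub_div_abs_rpow hp hδ hu hM x
  rw [HasFracLaplacian, hf_comp]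
  refine ⟨fun δ hδ => (integrableOn_comp_sub_left_iff δ x).2 (hf_int hδ), ?_⟩
  refine (((aecover_lt_abs.integral_tendsto_of_countably_generated hint).const_mul
    (1 / 2)).const_mul _).congr' ?_
  filter_upwards [self_mem_nhdsWithin] with δ hδ
  rw [setIntegral_comp_sub_left f, setIntegral_lt_abs_eq_half (hf_int hδ)]
  simp only [hf_symm]

end FracLaplacian

section FracLaplacianSineSeries

open Real

theorem one_sub_cos_nonneg (x : ℝ) : 0 ≤ 1 - cos x := sub_nonneg.2 (cos_le_one x)

theorem integrable_one_sub_cos_div {s : ℝ} (hs0 : 0 < s) (hs1 : s < 1) :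
    Integrable fun t : ℝ => (1 - cos t) / |t| ^ (1 + 2 * s) := by
  suffices IntegrableOn (fun t : ℝ => (1 - cos t) / t ^ (1 + 2 * s)) (Ioi 0) by
    simpa using integrable_comp_abs_of_integrableOn_Ioi this
  have hmeas (S : Set ℝ) : AEStronglyMeasurable
      (fun t : ℝ => (1 - cos t) / t ^ (1 + 2 * s)) (volume.restrict S) :=
    (by fun_prop : Measurable fun t : ℝ => (1 - cos t) / t ^ (1 + 2 * s)).aestronglyMeasurable
  have hnorm {t : ℝ} (ht : 0 < t) :
      ‖(1 - cos t) / t ^ (1 + 2 * s)‖ = (1 - cos t) / t ^ (1 + 2 * s) :=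
    norm_of_nonneg (div_nonneg (one_sub_cos_nonneg t) (by positivity))
  rw [← Ioc_union_Ioi_eq_Ioi (zero_le_one' ℝ)]
  refine IntegrableOn.union ?_ ?_
  · have hdom : IntegrableOn (fun t : ℝ => t ^ (1 - 2 * s)) (Ioc 0 1) :=
      (intervalIntegral.intervalIntegrable_rpow' (by linarith)).1
    refine hdom.mono' (hmeas _) ((ae_restrict_mem measurableSet_Ioc).mono fun t ht => ?_)
    rw [hnorm ht.1, div_le_iff₀ (rpow_pos_of_pos ht.1 _), ← rpow_add ht.1,
      show 1 - 2 * s + (1 + 2 * s) = (2 : ℕ) by push_cast; ring, rpow_natCast]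
    nlinarith [one_sub_sq_div_two_le_cos (x := t)]
  · have hdom : IntegrableOn (fun t : ℝ => 2 * t ^ (-(1 + 2 * s))) (Ioi 1) :=
      (integrableOn_Ioi_rpow_of_lt (by linarith) one_pos).const_mul 2
    refine hdom.mono' (hmeas _) ((ae_restrict_mem measurableSet_Ioi).mono fun t ht => ?_)
    have ht0 : 0 < t := one_pos.trans ht
    rw [hnorm ht0, rpow_neg ht0.le, div_eq_mul_inv]
    gcongr
    linarith [neg_one_le_cos t]

theorem one_sub_cos_mul_div_eq {κ : ℝ} (hκ : 0 ≤ κ) {s : ℝ} (hs : 0 < s) (t : ℝ) :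
    (1 - cos (κ * t)) / |t| ^ (1 + 2 * s)
      = κ ^ (2 * s) * (κ * ((1 - cos (κ * t)) / |κ * t| ^ (1 + 2 * s))) := by
  rcases hκ.eq_or_lt with rfl | hκ
  · simp
  · have := rpow_pos_of_pos hκ (2 * s)
    rw [abs_mul, abs_of_pos hκ, mul_rpow hκ.le (abs_nonneg t), rpow_one_add' hκ.le (by linarith)]
    field_simp

theorem integrable_one_sub_cos_mul_div {s κ : ℝ} (hs0 : 0 < s) (hs1 : s < 1) (hκ : 0 ≤ κ) :
    Integrable fun t : ℝ => (1 - cos (κ * t)) / |t| ^ (1 + 2 * s) := by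
  rcases hκ.eq_or_lt with rfl | hκ
  · simp
  · simp only [one_sub_cos_mul_div_eq hκ.le hs0]
    exact (((integrable_one_sub_cos_div hs0 hs1).comp_mul_left' hκ.ne').const_mul κ).const_mul _

theorem integral_one_sub_cos_mul_div {s κ : ℝ} (hs : 0 < s) (hκ : 0 ≤ κ) :
    ∫ t : ℝ, (1 - cos (κ * t)) / |t| ^ (1 + 2 * s)
      = κ ^ (2 * s) * ∫ t : ℝ, (1 - cos t) / |t| ^ (1 + 2 * s) := by
  rcases hκ.eq_or_lt with rfl | hκ
  · simp [zero_rpow (by linarith : 2 * s ≠ 0)]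
  · simp only [one_sub_cos_mul_div_eq hκ.le hs, integral_const_mul]
    rw [Measure.integral_comp_mul_left fun t => (1 - cos t) / |t| ^ (1 + 2 * s),
      abs_of_pos (inv_pos.2 hκ), smul_eq_mul, mul_inv_cancel_left₀ hκ.ne']

theorem secondDifference_sineSeries {ι : Type*} {a κ : ι → ℝ} {φ : ℝ} (ha : Summable a)
    (x t : ℝ) : secondDifference (sineSeries a κ φ) x t
      = ∑' i, 2 * (a i * sin (κ i * x + φ)) * (1 - cos (κ i * t)) := by
  have hterm (y : ℝ) : HasSum (fun i => a i * sin (κ i * y + φ)) (sineSeries a κ φ y) :=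
    (summable_mul_sin ha _).hasSum
  rw [secondDifference,
    ← ((((hterm x).mul_left 2).sub (hterm (x - t))).sub (hterm (x + t))).tsum_eq]
  refine tsum_congr fun i => ?_
  rw [show κ i * (x - t) + φ = κ i * x + φ - κ i * t by ring,
    show κ i * (x + t) + φ = κ i * x + φ + κ i * t by ring, sin_sub (κ i * x + φ),
    sin_add (κ i * x + φ)]
  ring

theorem integrable_tsum_of_summable_integral_norm {α ι : Type*} [MeasurableSpace α]
    {μ : Measure α} [Countable ι] {F : ι → α → ℝ} (hF : ∀ i, Integrable (F i) μ)
    (hsum : Summable fun i => ∫ x, ‖F i x‖ ∂μ) : Integrable (fun x => ∑' i, F i x) μ := by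
  refine ⟨(AEMeasurable.tsum fun i => (hF i).aemeasurable).aestronglyMeasurable, ?_⟩
  calc ∫⁻ x, ‖∑' i, F i x‖ₑ ∂μ
      ≤ ∫⁻ x, ∑' i, ‖F i x‖ₑ ∂μ := lintegral_mono fun x => enorm_tsum_le_tsum_enorm
    _ = ∑' i, ∫⁻ x, ‖F i x‖ₑ ∂μ := lintegral_tsum fun i => (hF i).aestronglyMeasurable.enorm
    _ = ∑' i, ENNReal.ofReal (∫ x, ‖F i x‖ ∂μ) :=
        tsum_congr fun i => (ofReal_integral_norm_eq_lintegral_enorm (hF i)).symm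
    _ < ⊤ := hsum.tsum_ofReal_lt_top

theorem hasFracLaplacian_sineSeries {ι : Type*} [Countable ι] {a κ : ι → ℝ} {φ s : ℝ}
    (hs0 : 0 < s) (hs1 : s < 1) (hκ : ∀ i, 0 ≤ κ i) (ha : Summable a)
    (haκ : Summable fun i => a i * κ i ^ (2 * s)) (x : ℝ) :
    HasFracLaplacian s (sineSeries a κ φ) x
      (fracLaplacianConst s * (∫ t : ℝ, (1 - cos t) / |t| ^ (1 + 2 * s)) *
        sineSeries (fun i => a i * κ i ^ (2 * s)) κ φ x) := by
  set I : ℝ := ∫ t : ℝ, (1 - cos t) / |t| ^ (1 + 2 * s)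
  set F : ι → ℝ → ℝ := fun i t =>
    2 * (a i * sin (κ i * x + φ)) * ((1 - cos (κ i * t)) / |t| ^ (1 + 2 * s)) with hFdef
  have hF (i) : Integrable (F i) := (integrable_one_sub_cos_mul_div hs0 hs1 (hκ i)).const_mul _
  have hF_integral (i) : ∫ t, F i t = 2 * I * (a i * κ i ^ (2 * s) * sin (κ i * x + φ)) := by
    rw [integral_const_mul, integral_one_sub_cos_mul_div hs0 (hκ i)]
    ring
  have hF_norm (i) : ∫ t, ‖F i t‖ = |∫ t, F i t| := by
    have hnn (t : ℝ) : 0 ≤ (1 - cos (κ i * t)) / |t| ^ (1 + 2 * s) :=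
      div_nonneg (one_sub_cos_nonneg _) (by positivity)
    simp only [hFdef, norm_mul _ ((_ : ℝ) / _), norm_of_nonneg (hnn _), integral_const_mul]
    rw [abs_mul, abs_of_nonneg (integral_nonneg hnn), norm_eq_abs]
  have hF_sum : Summable fun i => ∫ t, ‖F i t‖ := by
    simp only [hF_norm, hF_integral]
    exact ((summable_mul_sin haκ _).mul_left (2 * I)).abs
  have hsecond : (fun t => secondDifference (sineSeries a κ φ) x t / |t| ^ (1 + 2 * s))
      = fun t => ∑' i, F i t := by
    simp only [hFdef, secondDifference_sineSeries ha, ← tsum_div_const, mul_div_assoc]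
  have hint := integrable_tsum_of_summable_integral_norm hF hF_sum
  have hvalue : ∫ t, ∑' i, F i t = 2 * I * sineSeries (fun i => a i * κ i ^ (2 * s)) κ φ x := by
    rw [← (hasSum_integral_of_summable_integral_norm hF hF_sum).tsum_eq, sineSeries,
      ← tsum_mul_left]
    exact tsum_congr hF_integral
  rw [← hsecond] at hint
  convert hasFracLaplacian_of_integrable hs0 (continuous_sineSeries ha).measurable
    (abs_sineSeries_le ha) hint using 1
  rw [hsecond, hvalue]
  ring

end FracLaplacianSineSeries

section NonHolder

open Real

variable {ι : Type*} {b κ : ι → ℝ}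

/-- The companion `∑ b_i (1 - cos (κ_i x))` of the sine series: the even part, up to sign, of the
increment at `0` of a sine series with phase. -/
noncomputable def versineSeries (b κ : ι → ℝ) (x : ℝ) : ℝ :=
  ∑' i, b i * (1 - cos (κ i * x))

theorem summable_mul_one_sub_cos (hb : Summable b) (f : ι → ℝ) :
    Summable fun i => b i * (1 - cos (f i)) := by
  refine .of_norm_bounded (hb.abs.mul_right 2) fun i => ?_
  rw [norm_mul, norm_eq_abs, norm_of_nonneg (one_sub_cos_nonneg _)]
  gcongr
  linarith [neg_one_le_cos (f i)]

theorem sineSeries_sub_sineSeries_zero (hb : Summable b) (φ x : ℝ) :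
    sineSeries b κ φ x - sineSeries b κ φ 0
      = cos φ * sineSeries b κ 0 x - sin φ * versineSeries b κ x := by
  have hsin (ψ y : ℝ) : Summable fun i => b i * sin (κ i * y + ψ) := summable_mul_sin hb _
  rw [sineSeries, sineSeries, sineSeries, versineSeries, ← tsum_mul_left, ← tsum_mul_left,
    ← (hsin φ x).tsum_sub (hsin φ 0),
    ← ((hsin 0 x).mul_left _).tsum_sub ((summable_mul_one_sub_cos hb _).mul_left _)]
  refine tsum_congr fun i => ?_
  rw [mul_zero, zero_add, add_zero, sin_add]
  ring

theorem four_ninths_le_one_sub_cos {y : ℝ} (hy : y ∈ Icc 1 π) : 4 / 9 ≤ 1 - cos y := by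
  linarith [cos_le_cos_of_nonneg_of_le_pi zero_le_one hy.2 hy.1, cos_one_le]

theorem sum_le_versineSeries (hb0 : ∀ i, 0 ≤ b i) (hb : Summable b) {x : ℝ} {s : Finset ι}
    (hs : ∀ i ∈ s, κ i * x ∈ Icc 1 π) : 4 / 9 * ∑ i ∈ s, b i ≤ versineSeries b κ x := by
  rw [Finset.mul_sum]
  calc ∑ i ∈ s, 4 / 9 * b i ≤ ∑ i ∈ s, b i * (1 - cos (κ i * x)) := by
        refine Finset.sum_le_sum fun i hi => ?_
        rw [mul_comm]
        exact mul_le_mul_of_nonneg_left (four_ninths_le_one_sub_cos (hs i hi)) (hb0 i)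
    _ ≤ versineSeries b κ x :=
        (summable_mul_one_sub_cos hb _).sum_le_tsum s fun i _ =>
          mul_nonneg (hb0 i) (one_sub_cos_nonneg _)

theorem integral_sin_mul {k : ℝ} (hk : k ≠ 0) (x : ℝ) :
    ∫ t in (0 : ℝ)..x, sin (k * t) = (1 - cos (k * x)) / k := by
  rw [intervalIntegral.integral_comp_mul_left sin hk, integral_sin, mul_zero, cos_zero, smul_eq_mul,
    div_eq_inv_mul]

theorem integral_sineSeries [Countable ι] (hκ : ∀ i, κ i ≠ 0) (hb : Summable b) (x : ℝ) :
    ∫ t in (0 : ℝ)..x, sineSeries b κ 0 t = versineSeries (fun i => b i / κ i) κ x := by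
  have h := intervalIntegral.hasSum_integral_of_dominated_convergence (μ := volume) (a := 0)
    (b := x) (F := fun i t => b i * sin (κ i * t + 0)) (f := sineSeries b κ 0) (fun i _ => |b i|)
    (fun i => by fun_prop) (fun i => .of_forall fun t _ => norm_mul_sin_le _ _)
    (.of_forall fun t _ => hb.abs) intervalIntegrable_const
    (.of_forall fun t _ => (summable_mul_sin hb _).hasSum)
  rw [← h.tsum_eq, versineSeries]
  refine tsum_congr fun i => ?_
  simp only [add_zero, intervalIntegral.integral_const_mul, integral_sin_mul (hκ i)]
  ring

theorem summable_div_mul_one_sub_cos (hκ : ∀ i, 0 < κ i) (hb : Summable b) (x : ℝ) :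
    Summable fun i => b i / κ i * (1 - cos (κ i * x)) := by
  refine .of_norm_bounded (hb.abs.mul_right |x|) fun i => ?_
  have hcos : 1 - cos (κ i * x) ≤ κ i * |x| := by
    have h := abs_cos_sub_cos_le 0 (κ i * x)
    rw [cos_zero, zero_sub, abs_neg, abs_mul, abs_of_pos (hκ i)] at h
    exact (le_abs_self _).trans h
  rw [norm_mul, norm_div, norm_of_nonneg (one_sub_cos_nonneg _), norm_of_nonneg (hκ i).le,
    norm_eq_abs, div_mul_eq_mul_div, div_le_iff₀ (hκ i), mul_assoc, mul_comm |x|]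
  gcongr

theorem sum_le_integral_sineSeries [Countable ι] (hκ : ∀ i, 0 < κ i) (hb0 : ∀ i, 0 ≤ b i)
    (hb : Summable b) {x : ℝ} (hx : 0 < x) {s : Finset ι} (hs : ∀ i ∈ s, κ i * x ∈ Icc 1 π) :
    4 / 9 * (∑ i ∈ s, b i) * x ≤ π * ∫ t in (0 : ℝ)..x, sineSeries b κ 0 t := by
  rw [integral_sineSeries (fun i => (hκ i).ne') hb, versineSeries, ← tsum_mul_left, mul_right_comm,
    Finset.mul_sum]
  have hsum := (summable_div_mul_one_sub_cos hκ hb x).mul_left π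
  refine le_trans (Finset.sum_le_sum fun i hi => ?_) (hsum.sum_le_tsum s fun i _ =>
    mul_nonneg pi_nonneg <| mul_nonneg (div_nonneg (hb0 i) (hκ i).le) (one_sub_cos_nonneg _))
  have hκx : x ≤ π / κ i := (le_div_iff₀' (hκ i)).2 (hs i hi).2
  calc 4 / 9 * x * b i ≤ (1 - cos (κ i * x)) * (π / κ i) * b i :=
        mul_le_mul_of_nonneg_right (mul_le_mul (four_ninths_le_one_sub_cos (hs i hi)) hκx hx.le
          (one_sub_cos_nonneg _)) (hb0 i)
    _ = π * (b i / κ i * (1 - cos (κ i * x))) := by ring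

theorem sum_le_of_abs_versineSeries_le (hb0 : ∀ i, 0 ≤ b i) (hb : Summable b) {x M : ℝ}
    (h : |versineSeries b κ x| ≤ M) {s : Finset ι} (hs : ∀ i ∈ s, κ i * x ∈ Icc 1 π) :
    ∑ i ∈ s, b i ≤ 9 * M := by
  have hM : 0 ≤ M := (abs_nonneg _).trans h
  linarith [sum_le_versineSeries hb0 hb hs, le_of_abs_le h]

-- Near `0` an odd sine series is small termwise, so it is integrated, which makes all its terms
-- nonnegative.
theorem sum_le_of_abs_sineSeries_le [Countable ι] (hκ : ∀ i, 0 < κ i) (hb0 : ∀ i, 0 ≤ b i)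
    (hb : Summable b) {x M : ℝ} (hx : 0 < x) (h : ∀ t ∈ Ioc 0 x, |sineSeries b κ 0 t| ≤ M)
    {s : Finset ι} (hs : ∀ i ∈ s, κ i * x ∈ Icc 1 π) : ∑ i ∈ s, b i ≤ 9 * M := by
  have hM : 0 ≤ M := (abs_nonneg _).trans (h x ⟨hx, le_rfl⟩)
  have hint : ∫ t in (0 : ℝ)..x, sineSeries b κ 0 t ≤ M * x := by
    refine (le_abs_self _).trans ?_
    simpa [abs_of_pos hx] using intervalIntegral.norm_integral_le_of_norm_le_const (a := 0) (b := x)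
      (f := sineSeries b κ 0) (C := M) (by rw [uIoc_of_le hx.le]; exact h)
  have := calc 4 / 9 * (∑ i ∈ s, b i) * x ≤ π * ∫ t in (0 : ℝ)..x, sineSeries b κ 0 t :=
        sum_le_integral_sineSeries hκ hb0 hb hx hs
    _ ≤ 4 * (M * x) :=
        (mul_le_mul_of_nonneg_left hint pi_nonneg).trans
          (mul_le_mul_of_nonneg_right pi_le_four (by positivity))
    _ = 4 * M * x := by ring
  linarith [le_of_mul_le_mul_right this hx]

theorem sin_nat_mul_pi_div_two_eq_zero_or (n : ℕ) :
    sin (n * (π / 2)) = 0 ∨ cos (n * (π / 2)) = 0 := by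
  have h : sin (2 * (n * (π / 2))) = 0 := by
    rw [show 2 * (n * (π / 2)) = n * π by ring, sin_nat_mul_pi]
  rw [sin_two_mul] at h
  simpa using h

theorem sum_le_of_abs_sineSeries_sub_le [Countable ι] (hκ : ∀ i, 0 < κ i) (hb0 : ∀ i, 0 ≤ b i)
    (hb : Summable b) (n : ℕ) {C r ρ : ℝ} (hr : 0 ≤ r)
    (h : ∀ x ∈ Icc 0 ρ, |sineSeries b κ (n * (π / 2)) x - sineSeries b κ (n * (π / 2)) 0|
      ≤ C * x ^ r)
    {x : ℝ} (hx : x ∈ Ioc 0 ρ) {s : Finset ι} (hs : ∀ i ∈ s, κ i * x ∈ Icc 1 π) :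
    ∑ i ∈ s, b i ≤ 9 * (C * x ^ r) := by
  have hC : 0 ≤ C := nonneg_of_mul_nonneg_left
    ((abs_nonneg _).trans (h x (Ioc_subset_Icc_self hx))) (rpow_pos_of_pos hx.1 r)
  simp only [sineSeries_sub_sineSeries_zero hb] at h
  rcases sin_nat_mul_pi_div_two_eq_zero_or n with h0 | h0
  · have hcos : |cos (n * (π / 2))| = 1 := by rw [abs_cos_eq_sqrt_one_sub_sin_sq, h0]; simp
    refine sum_le_of_abs_sineSeries_le hκ hb0 hb hx.1 (fun t ht => ?_) hs
    have := h t ⟨ht.1.le, ht.2.trans hx.2⟩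
    rw [h0, zero_mul, sub_zero, abs_mul, hcos, one_mul] at this
    exact this.trans (by gcongr; exacts [ht.1.le, ht.2])
  · have hsin : |sin (n * (π / 2))| = 1 := by rw [abs_sin_eq_sqrt_one_sub_cos_sq, h0]; simp
    refine sum_le_of_abs_versineSeries_le hb0 hb ?_ hs
    have := h x (Ioc_subset_Icc_self hx)
    rwa [h0, zero_mul, zero_sub, abs_neg, abs_mul, hsin, one_mul] at this

theorem exists_sum_le_of_isHolder [Countable ι] {a : ι → ℝ} {γ ε ρ : ℝ} (hκ : ∀ i, 0 < κ i)
    (ha0 : ∀ i, 0 ≤ a i) (ha : Summable a) (hγ : 0 ≤ γ) (haκ : Summable fun i => a i * κ i ^ γ)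
    (hε : 0 < ε) (hρ : 0 < ρ) (h : IsHolder (γ + ε) (Icc (-ρ) ρ) (sineSeries a κ 0)) :
    ∃ δ C : ℝ, 0 < δ ∧ ∀ x ∈ Ioc 0 ρ, ∀ s : Finset ι, (∀ i ∈ s, κ i * x ∈ Icc 1 π) →
      ∑ i ∈ s, a i ≤ C * x ^ (γ + δ) := by
  have hpow (k : ℕ) (hk : k ≤ ⌊γ⌋₊) : Summable fun i => a i * κ i ^ k :=
    summable_mul_pow_of_le (fun i => (hκ i).le) ha haκ ((Nat.cast_le.2 hk).trans (Nat.floor_le hγ))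
  obtain ⟨δ, C, hδ, hC⟩ := h.exists_abs_iteratedDeriv_sub_le hγ hε hρ (contDiff_sineSeries hpow)
  rw [iteratedDeriv_sineSeries hpow, zero_add] at hC
  refine ⟨δ, 9 * C, hδ, fun x hx s hs => ?_⟩
  have hderiv := sum_le_of_abs_sineSeries_sub_le hκ
    (fun i => mul_nonneg (ha0 i) (pow_nonneg (hκ i).le _)) (hpow _ le_rfl) ⌊γ⌋₊
    (by linarith [Nat.floor_le hγ]) hC hx hs
  calc ∑ i ∈ s, a i ≤ ∑ i ∈ s, a i * (κ i * x) ^ ⌊γ⌋₊ := Finset.sum_le_sum fun i hi =>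
        le_mul_of_one_le_right (ha0 i) (one_le_pow₀ (hs i hi).1)
    _ = (∑ i ∈ s, a i * κ i ^ ⌊γ⌋₊) * x ^ ⌊γ⌋₊ := by
        simp only [Finset.sum_mul, mul_pow, mul_assoc]
    _ ≤ 9 * (C * x ^ (γ - ⌊γ⌋₊ + δ)) * x ^ ⌊γ⌋₊ := by gcongr; exact pow_nonneg hx.1.le _
    _ = 9 * C * x ^ (γ + δ) := by
        rw [← mul_assoc, mul_assoc, ← rpow_natCast, ← rpow_add hx.1]
        ring_nf

end NonHolder

section ArctanKernel

open Real

/-- The kernel whose Mellin transform at `S = sin x` is, up to a constant, the Fourier series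
`∑ (2 i + 1) ^ (-1 - θ) sin ((2 i + 1) x)`: the latter depends on `x` through `sin x` only. -/
noncomputable def arctanKernel (S t : ℝ) : ℝ := arctan (S / sinh t)

theorem two_mul_exp_neg_div (t : ℝ) : 2 * exp (-t) / (1 - exp (-t) ^ 2) = 1 / sinh t := by
  have h : 1 - exp (-t) ^ 2 = 2 * exp (-t) * sinh t := by
    rw [sinh_eq, exp_neg]
    field_simp
  rw [h, div_mul_cancel_left₀ (by positivity), one_div]

theorem hasSum_pow_odd_div {z : ℂ} (hz : ‖z‖ < 1) :
    HasSum (fun n : ℕ => z ^ (2 * n + 1) / ↑(2 * n + 1)) (Complex.log ((1 + z) / (1 - z)) / 2) := by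
  obtain ⟨w, rfl⟩ : ∃ w, z = w * Complex.I := ⟨-(z * Complex.I), by
    rw [neg_mul, mul_assoc, Complex.I_mul_I, mul_neg_one, neg_neg]⟩
  convert! (Complex.hasSum_arctan (z := w) (by simpa using hz)).mul_left Complex.I using 1
  · funext n
    rw [mul_pow, pow_succ Complex.I, pow_mul Complex.I, Complex.I_sq]
    ring
  · rw [Complex.arctan]
    linear_combination (1 / 2) * Complex.log ((1 + w * Complex.I) / (1 - w * Complex.I))
      * Complex.I_mul_I

theorem arg_eq_arctan_of_re_pos {w : ℂ} (hw : 0 < w.re) : w.arg = arctan (w.im / w.re) := by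
  obtain ⟨h₁, h₂⟩ := abs_lt.1 (Complex.abs_arg_lt_pi_div_two_iff.2 (Or.inl hw))
  rw [← Complex.tan_arg, arctan_tan h₁ h₂]

theorem arg_one_add_div_one_sub {z : ℂ} (hz : ‖z‖ < 1) :
    ((1 + z) / (1 - z)).arg = arctan (2 * z.im / (1 - ‖z‖ ^ 2)) := by
  have hnorm : 0 < 1 - ‖z‖ ^ 2 := by nlinarith [norm_nonneg z]
  have hne : 0 < Complex.normSq (1 - z) := Complex.normSq_pos.2 <| sub_ne_zero.2 <| by
    rintro rfl
    simp at hz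
  have hsq : ‖z‖ ^ 2 = z.re ^ 2 + z.im ^ 2 := by
    rw [← Complex.normSq_eq_norm_sq, Complex.normSq_apply]
    ring
  have hre : ((1 + z) / (1 - z)).re = (1 - ‖z‖ ^ 2) / Complex.normSq (1 - z) := by
    rw [Complex.div_re, ← add_div, hsq]
    simp
    ring
  have him : ((1 + z) / (1 - z)).im = 2 * z.im / Complex.normSq (1 - z) := by
    rw [Complex.div_im, ← sub_div]
    simp
    ring
  rw [arg_eq_arctan_of_re_pos (hre ▸ div_pos hnorm hne), hre, him,
    div_div_div_cancel_right₀ hne.ne']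

theorem hasSum_exp_neg_mul_sin {t : ℝ} (ht : 0 < t) (x : ℝ) :
    HasSum (fun i : ℕ => sin ((2 * i + 1) * x) / (2 * i + 1) * exp (-((2 * i + 1) * t)))
      (arctanKernel (sin x) t / 2) := by
  set z : ℂ := Complex.exp (-t + x * Complex.I) with hzdef
  have hnorm : ‖z‖ = exp (-t) := by rw [hzdef, Complex.norm_exp]; simp
  have him : z.im = exp (-t) * sin x := by rw [hzdef, Complex.exp_im]; simp
  have hz : ‖z‖ < 1 := by simpa [hnorm] using ht
  convert Complex.hasSum_im (hasSum_pow_odd_div hz) using 1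
  · funext i
    have hpow : z ^ (2 * i + 1)
        = Complex.exp ((-((2 * i + 1) * t) : ℝ) + ((2 * i + 1) * x : ℝ) * Complex.I) := by
      rw [hzdef, ← Complex.exp_nat_mul]
      push_cast
      ring_nf
    rw [← Complex.ofReal_natCast, Complex.div_ofReal_im, hpow, Complex.exp_im]
    simp
    ring
  · rw [show (2 : ℂ) = (2 : ℝ) by simp, Complex.div_ofReal_im, Complex.log_im,
      arg_one_add_div_one_sub hz, hnorm, him, ← mul_assoc, mul_div_right_comm, two_mul_exp_neg_div,
      arctanKernel, one_div_mul_eq_div]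

theorem arctanKernel_le_arctanKernel {S S' t : ℝ} (ht : 0 < t) (h : S' ≤ S) :
    arctanKernel S' t ≤ arctanKernel S t :=
  arctan_mono (div_le_div_of_nonneg_right h (sinh_pos_iff.2 ht).le)

theorem arctanKernel_sub_le_pi (S S' t : ℝ) : arctanKernel S t - arctanKernel S' t ≤ π := by
  rw [arctanKernel, arctanKernel]
  linarith [arctan_lt_pi_div_two (S / sinh t), neg_pi_div_two_lt_arctan (S' / sinh t)]

theorem arctan_sub_arctan_le {x y : ℝ} (h : y ≤ x) : arctan x - arctan y ≤ x - y := by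
  have hderiv : ∀ z, deriv arctan z ≤ 1 := fun z => by
    rw [Real.deriv_arctan]
    exact div_le_one_of_le₀ (by nlinarith [sq_nonneg z]) (by positivity)
  simpa using image_sub_le_mul_sub_of_deriv_le differentiable_arctan hderiv h

theorem mul_sub_le_arctan_sub_arctan {M x y : ℝ} (hx : x ≤ M) (hy : -M ≤ y) (h : y ≤ x) :
    1 / (1 + M ^ 2) * (x - y) ≤ arctan x - arctan y := by
  refine (convex_Icc (-M) M).mul_sub_le_image_sub_of_le_deriv continuous_arctan.continuousOn
    differentiable_arctan.differentiableOn (fun z hz => ?_) y ⟨hy, h.trans hx⟩ x ⟨hy.trans h, hx⟩ h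
  rw [interior_Icc] at hz
  rw [Real.deriv_arctan]
  exact one_div_le_one_div_of_le (by positivity) (by linarith [sq_le_sq' hz.1.le hz.2.le])

theorem arctanKernel_sub_le_div {S S' t : ℝ} (ht : 0 < t) (h : S' ≤ S) :
    arctanKernel S t - arctanKernel S' t ≤ (S - S') / t := by
  have hsinh : 0 < sinh t := sinh_pos_iff.2 ht
  calc arctanKernel S t - arctanKernel S' t ≤ S / sinh t - S' / sinh t :=
        arctan_sub_arctan_le (div_le_div_of_nonneg_right h hsinh.le)
    _ = (S - S') / sinh t := (sub_div _ _ _).symm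
    _ ≤ (S - S') / t :=
        div_le_div_of_nonneg_left (sub_nonneg.2 h) ht (self_le_sinh_iff.2 ht.le)

theorem mul_sub_le_arctanKernel_sub {S S' t : ℝ} (ht : 0 < t) (hS : S ≤ 1) (hS' : -1 ≤ S')
    (h : S' ≤ S) :
    sinh t / cosh t ^ 2 * (S - S') ≤ arctanKernel S t - arctanKernel S' t := by
  have hsinh : 0 < sinh t := sinh_pos_iff.2 ht
  have hS' : -(1 / sinh t) ≤ S' / sinh t := by
    rw [← neg_div]
    gcongr
  refine le_trans (le_of_eq ?_) (mul_sub_le_arctan_sub_arctan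
    (div_le_div_of_nonneg_right hS hsinh.le) hS' (div_le_div_of_nonneg_right h hsinh.le))
  rw [cosh_sq]
  field_simp

theorem abs_arctanKernel_le {S t : ℝ} (hS : S ∈ Icc (-1) 1) (ht : 0 < t) :
    |arctanKernel S t| ≤ 2 * exp (-t) := by
  have hle_one : exp (-t) < 1 := by simpa using ht
  have hone : arctanKernel 1 t ≤ 2 * exp (-t) := by
    rw [arctanKernel, ← two_mul_exp_neg_div, ← two_mul_arctan (by linarith [exp_pos (-t)]) hle_one]
    simpa using arctan_sub_arctan_le (exp_pos (-t)).le
  have hneg : arctanKernel (-1) t = -arctanKernel 1 t := by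
    rw [arctanKernel, arctanKernel, neg_div, arctan_neg]
  have hlow := arctanKernel_le_arctanKernel ht hS.1
  have hup := arctanKernel_le_arctanKernel ht hS.2
  exact abs_le.2 ⟨by linarith, by linarith⟩

end ArctanKernel

section OddSineIntegral

open Real

theorem integrableOn_rpow_mul_exp_neg_mul {θ r : ℝ} (hθ : 0 < θ) (hr : 0 < r) :
    IntegrableOn (fun t : ℝ => t ^ (θ - 1) * exp (-(r * t))) (Ioi 0) := by
  simpa using integrableOn_rpow_mul_exp_neg_mul_rpow (s := θ - 1) (p := 1) (by linarith) one_pos hr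

theorem hasSum_integral_rpow_mul_exp_neg {ι : Type*} [Countable ι] {θ : ℝ} (hθ : 0 < θ)
    {c r : ι → ℝ} (hr : ∀ i, 0 < r i) (hsum : Summable fun i => c i * r i ^ (-θ)) :
    HasSum (fun i => c i * r i ^ (-θ) * Gamma θ)
      (∫ t in Ioi (0 : ℝ), t ^ (θ - 1) * ∑' i, c i * exp (-(r i * t))) := by
  have hval (i) : ∫ t in Ioi (0 : ℝ), t ^ (θ - 1) * exp (-(r i * t)) = r i ^ (-θ) * Gamma θ := by
    rw [integral_rpow_mul_exp_neg_mul_Ioi hθ (hr i), one_div, inv_rpow (hr i).le,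
      rpow_neg (hr i).le]
  have hnorm (i) : ∫ t in Ioi (0 : ℝ), ‖c i * (t ^ (θ - 1) * exp (-(r i * t)))‖
      = |c i * r i ^ (-θ) * Gamma θ| := by
    have := Gamma_pos_of_pos hθ
    rw [mul_assoc, ← hval i, abs_mul, abs_of_nonneg (setIntegral_nonneg measurableSet_Ioi
      fun t (ht : 0 < t) => by positivity), ← integral_const_mul]
    refine setIntegral_congr_fun measurableSet_Ioi fun t (ht : 0 < t) => ?_
    rw [norm_mul, norm_of_nonneg (by positivity : 0 ≤ t ^ (θ - 1) * exp (-(r i * t))), norm_eq_abs]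
  have h := hasSum_integral_of_summable_integral_norm
    (fun i => (integrableOn_rpow_mul_exp_neg_mul hθ (hr i)).const_mul (c i))
    (by simpa only [hnorm] using (hsum.mul_right (Gamma θ)).abs)
  simp only [integral_const_mul, hval] at h
  simpa only [← tsum_mul_left, mul_left_comm, mul_assoc] using h

/-- The sum of `(2 i + 1) ^ (-1 - θ) sin ((2 i + 1) x)` as a function of `S = sin x`. -/
noncomputable def oddSineIntegral (θ S : ℝ) : ℝ :=
  (∫ t in Ioi (0 : ℝ), t ^ (θ - 1) * arctanKernel S t) / (2 * Gamma θ)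

theorem summable_odd_rpow {p : ℝ} (hp : p < -1) : Summable fun i : ℕ => (2 * i + 1 : ℝ) ^ p := by
  have hinj : Function.Injective fun i : ℕ => 2 * i + 1 := fun i j h => by simpa using h
  simpa [Function.comp_def] using (summable_nat_rpow.2 hp).comp_injective hinj

theorem hasSum_odd_rpow_mul_sin {θ : ℝ} (hθ : 0 < θ) (x : ℝ) :
    HasSum (fun i : ℕ => (2 * i + 1 : ℝ) ^ (-1 - θ) * sin ((2 * i + 1) * x))
      (oddSineIntegral θ (sin x)) := by
  have hcoeff (i : ℕ) : sin ((2 * i + 1) * x) / (2 * i + 1) * (2 * i + 1 : ℝ) ^ (-θ)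
      = (2 * i + 1 : ℝ) ^ (-1 - θ) * sin ((2 * i + 1) * x) := by
    rw [sub_eq_add_neg, rpow_add (by positivity), rpow_neg_one]
    ring
  have h := hasSum_integral_rpow_mul_exp_neg hθ
    (c := fun i : ℕ => sin ((2 * i + 1) * x) / (2 * i + 1))
    (r := fun i : ℕ => (2 * i + 1 : ℝ)) (fun i => by positivity)
    (by simpa only [hcoeff] using summable_mul_sin (summable_odd_rpow (by linarith)) _)
  simp only [hcoeff] at h
  have hint : ∫ t in Ioi (0 : ℝ), t ^ (θ - 1) * ∑' i : ℕ, sin ((2 * i + 1) * x) / (2 * i + 1)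
      * exp (-((2 * i + 1) * t))
      = (∫ t in Ioi (0 : ℝ), t ^ (θ - 1) * arctanKernel (sin x) t) / 2 := by
    rw [← integral_div]
    refine setIntegral_congr_fun measurableSet_Ioi fun t ht => ?_
    rw [(hasSum_exp_neg_mul_sin ht x).tsum_eq, mul_div_assoc]
  rw [hint] at h
  have hΓ := (Gamma_pos_of_pos hθ).ne'
  have h := h.div_const (Gamma θ)
  rw [div_div, ← oddSineIntegral] at h
  simpa only [mul_div_cancel_right₀ _ hΓ] using h

theorem integrableOn_rpow_mul_arctanKernel {θ S : ℝ} (hθ : 0 < θ) (hS : S ∈ Icc (-1) 1) :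
    IntegrableOn (fun t : ℝ => t ^ (θ - 1) * arctanKernel S t) (Ioi 0) := by
  have hmeas : Measurable fun t : ℝ => t ^ (θ - 1) * arctanKernel S t := by
    unfold arctanKernel
    fun_prop
  refine ((integrableOn_rpow_mul_exp_neg_mul hθ one_pos).const_mul 2).mono'
    hmeas.aestronglyMeasurable ((ae_restrict_mem measurableSet_Ioi).mono fun t (ht : 0 < t) => ?_)
  rw [norm_mul, norm_of_nonneg (by positivity), norm_eq_abs, one_mul, mul_left_comm]
  gcongr
  exact abs_arctanKernel_le hS ht

theorem integrableOn_rpow_mul_arctanKernel_sub {θ S S' : ℝ} (hθ : 0 < θ) (hS : S ∈ Icc (-1) 1)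
    (hS' : S' ∈ Icc (-1) 1) :
    IntegrableOn (fun t : ℝ => t ^ (θ - 1) * (arctanKernel S t - arctanKernel S' t)) (Ioi 0) := by
  simp only [mul_sub]
  exact (integrableOn_rpow_mul_arctanKernel hθ hS).sub (integrableOn_rpow_mul_arctanKernel hθ hS')

theorem oddSineIntegral_sub {θ S S' : ℝ} (hθ : 0 < θ) (hS : S ∈ Icc (-1) 1)
    (hS' : S' ∈ Icc (-1) 1) : oddSineIntegral θ S - oddSineIntegral θ S'
      = (∫ t in Ioi (0 : ℝ), t ^ (θ - 1) * (arctanKernel S t - arctanKernel S' t))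
        / (2 * Gamma θ) := by
  rw [oddSineIntegral, oddSineIntegral, ← sub_div, ← integral_sub
    (integrableOn_rpow_mul_arctanKernel hθ hS) (integrableOn_rpow_mul_arctanKernel hθ hS')]
  simp only [mul_sub]

theorem oddSineIntegral_mono {θ S S' : ℝ} (hθ : 0 < θ) (hS : S ∈ Icc (-1) 1)
    (hS' : S' ∈ Icc (-1) 1) (h : S' ≤ S) : oddSineIntegral θ S' ≤ oddSineIntegral θ S := by
  have := Gamma_pos_of_pos hθ
  rw [← sub_nonneg, oddSineIntegral_sub hθ hS hS']
  refine div_nonneg (setIntegral_nonneg measurableSet_Ioi fun t (ht : 0 < t) => ?_) (by positivity)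
  exact mul_nonneg (by positivity) (sub_nonneg.2 (arctanKernel_le_arctanKernel ht h))

end OddSineIntegral

section Increments

open Real

theorem setIntegral_Ioc_rpow_mul_le {f : ℝ → ℝ} {M p r : ℝ} (hp : 0 < p) (hr : 0 ≤ r)
    (hf : ∀ t, f t ≤ M) (hint : IntegrableOn (fun t => t ^ (p - 1) * f t) (Ioi 0)) :
    ∫ t in Ioc 0 r, t ^ (p - 1) * f t ≤ M * (r ^ p / p) := by
  have hpow : IntegrableOn (fun t : ℝ => t ^ (p - 1)) (Ioc 0 r) :=
    (intervalIntegral.intervalIntegrable_rpow' (by linarith)).1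
  calc ∫ t in Ioc 0 r, t ^ (p - 1) * f t ≤ ∫ t in Ioc 0 r, t ^ (p - 1) * M :=
        setIntegral_mono_on (hint.mono_set Ioc_subset_Ioi_self) (hpow.mul_const M)
          measurableSet_Ioc fun t ht => mul_le_mul_of_nonneg_left (hf t) (rpow_nonneg ht.1.le _)
    _ = M * (r ^ p / p) := by
        rw [integral_mul_const, ← intervalIntegral.integral_of_le hr,
          integral_rpow (Or.inl (by linarith)), sub_add_cancel, zero_rpow hp.ne', sub_zero,
          mul_comm]

theorem setIntegral_Ioi_rpow_mul_le {f : ℝ → ℝ} {p q r : ℝ} (hpq : p ≤ q) (hr : 0 < r)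
    (hf : ∀ t, 0 < t → 0 ≤ f t) (hp : IntegrableOn (fun t => t ^ (p - 1) * f t) (Ioi 0))
    (hq : IntegrableOn (fun t => t ^ (q - 1) * f t) (Ioi 0)) :
    ∫ t in Ioi r, t ^ (p - 1) * f t ≤ r ^ (p - q) * ∫ t in Ioi 0, t ^ (q - 1) * f t := by
  have hsub : Ioi r ⊆ Ioi 0 := Ioi_subset_Ioi hr.le
  rw [← integral_const_mul]
  refine (setIntegral_mono_on (hp.mono_set hsub) ((hq.mono_set hsub).const_mul _) measurableSet_Ioi
    fun t ht => ?_).trans (setIntegral_mono_set (hq.const_mul _) ?_ hsub.eventuallyLE)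
  · have ht0 : 0 < t := hr.trans ht
    have hsplit : t ^ (p - 1) = t ^ (p - q) * t ^ (q - 1) := by
      rw [← rpow_add ht0, sub_add_sub_cancel]
    rw [hsplit, ← mul_assoc]
    have := hf t ht0
    exact mul_le_mul_of_nonneg_right (mul_le_mul_of_nonneg_right
      (rpow_le_rpow_of_nonpos hr (mem_Ioi.1 ht).le (by linarith)) (by positivity)) this
  · filter_upwards [ae_restrict_mem measurableSet_Ioi] with t (ht : 0 < t)
    have := hf t ht
    positivity

theorem setIntegral_Ioi_rpow_mul_le_of_le_div {f : ℝ → ℝ} {d p : ℝ} (hp : p < 1) (hd : 0 < d)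
    (hf : ∀ t, 0 < t → f t ≤ d / t) (hint : IntegrableOn (fun t => t ^ (p - 1) * f t) (Ioi 0)) :
    ∫ t in Ioi d, t ^ (p - 1) * f t ≤ 1 / (1 - p) * d ^ p := by
  have hp2 : p - 2 < -1 := by linarith
  calc ∫ t in Ioi d, t ^ (p - 1) * f t ≤ ∫ t in Ioi d, d * t ^ (p - 2) := by
        refine setIntegral_mono_on (hint.mono_set (Ioi_subset_Ioi hd.le))
          ((integrableOn_Ioi_rpow_of_lt hp2 hd).const_mul d) measurableSet_Ioi fun t ht => ?_
        have ht0 : 0 < t := hd.trans ht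
        refine (mul_le_mul_of_nonneg_left (hf t ht0) (by positivity)).trans (le_of_eq ?_)
        rw [show p - 2 = p - 1 - 1 by ring, rpow_sub_one ht0.ne' (p - 1)]
        ring
    _ = 1 / (1 - p) * d ^ p := by
        rw [integral_const_mul, integral_Ioi_rpow_of_lt hp2 hd, show p - 2 + 1 = -(1 - p) by ring,
          show -(1 - p) = p - 1 by ring, rpow_sub_one hd.ne', ← neg_sub 1 p]
        have : 1 - p ≠ 0 := by linarith
        field_simp

theorem setIntegral_Ioi_eq_add {g : ℝ → ℝ} {r : ℝ} (hr : 0 ≤ r) (hg : IntegrableOn g (Ioi 0)) :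
    ∫ t in Ioi 0, g t = (∫ t in Ioc 0 r, g t) + ∫ t in Ioi r, g t := by
  rw [← Ioc_union_Ioi_eq_Ioi hr, setIntegral_union (Ioc_disjoint_Ioi le_rfl) measurableSet_Ioi
    (hg.mono_set Ioc_subset_Ioi_self) (hg.mono_set (Ioi_subset_Ioi hr))]

theorem oddSineIntegral_sub_le_add {p r S S' σ : ℝ} (hp : 0 < p) (hσ : 0 ≤ σ) (hr : 0 < r)
    (hS : S ∈ Icc (-1) 1) (hS' : S' ∈ Icc (-1) 1) (h : S' ≤ S) :
    oddSineIntegral p S - oddSineIntegral p S' ≤ π / p / (2 * Gamma p) * r ^ p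
      + Gamma (p + σ) / Gamma p
        * (r ^ (-σ) * (oddSineIntegral (p + σ) S - oddSineIntegral (p + σ) S')) := by
  have hq : 0 < p + σ := by linarith
  have := Gamma_pos_of_pos hp
  have := Gamma_pos_of_pos hq
  have hint := integrableOn_rpow_mul_arctanKernel_sub hp hS hS'
  have hnear := setIntegral_Ioc_rpow_mul_le hp hr.le (arctanKernel_sub_le_pi S S') hint
  have hfar := setIntegral_Ioi_rpow_mul_le (le_add_of_nonneg_right hσ) hr
    (fun t ht => sub_nonneg.2 (arctanKernel_le_arctanKernel ht h)) hint
    (integrableOn_rpow_mul_arctanKernel_sub hq hS hS')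
  rw [sub_add_cancel_left] at hfar
  rw [oddSineIntegral_sub hp hS hS', oddSineIntegral_sub hq hS hS',
    setIntegral_Ioi_eq_add hr.le hint]
  refine (div_le_div_of_nonneg_right (add_le_add hnear hfar) (by positivity)).trans (le_of_eq ?_)
  field_simp

theorem oddSineIntegral_sub_le_rpow {p S S' : ℝ} (hp : 0 < p) (hp1 : p < 1)
    (hS : S ∈ Icc (-1) 1) (hS' : S' ∈ Icc (-1) 1) (h : S' ≤ S) :
    oddSineIntegral p S - oddSineIntegral p S'
      ≤ (π / p + 1 / (1 - p)) / (2 * Gamma p) * (S - S') ^ p := by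
  obtain rfl | hlt := h.eq_or_lt
  · simp [hp.ne']
  have := Gamma_pos_of_pos hp
  have hd : 0 < S - S' := sub_pos.2 hlt
  have hint := integrableOn_rpow_mul_arctanKernel_sub hp hS hS'
  have hnear := setIntegral_Ioc_rpow_mul_le hp hd.le (arctanKernel_sub_le_pi S S') hint
  have hfar := setIntegral_Ioi_rpow_mul_le_of_le_div hp1 hd
    (fun t ht => arctanKernel_sub_le_div ht h) hint
  rw [oddSineIntegral_sub hp hS hS', setIntegral_Ioi_eq_add hd.le hint]
  refine (div_le_div_of_nonneg_right (add_le_add hnear hfar) (by positivity)).trans (le_of_eq ?_)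
  ring

theorem exists_mul_le_oddSineIntegral_sub {q : ℝ} (hq : 0 < q) :
    ∃ c, 0 < c ∧ ∀ S ∈ Icc (-1 : ℝ) 1, ∀ S' ∈ Icc (-1 : ℝ) 1, S' ≤ S →
      c * (S - S') ≤ oddSineIntegral q S - oddSineIntegral q S' := by
  set k : ℝ → ℝ := fun t => t ^ (q - 1) * (sinh t / cosh t ^ 2)
  have := Gamma_pos_of_pos hq
  have hk_pos : ∀ t, 0 < t → 0 < k t := fun t ht => by
    have := sinh_pos_iff.2 ht
    positivity
  have hk_le {S S' : ℝ} (hS : S ≤ 1) (hS' : -1 ≤ S') (h : S' ≤ S) {t : ℝ} (ht : 0 < t) :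
      k t * (S - S') ≤ t ^ (q - 1) * (arctanKernel S t - arctanKernel S' t) := by
    rw [mul_assoc]
    exact mul_le_mul_of_nonneg_left (mul_sub_le_arctanKernel_sub ht hS hS' h) (by positivity)
  have hk_int : IntegrableOn k (Ioi 0) := by
    refine (integrableOn_rpow_mul_arctanKernel_sub (S := 1) (S' := -1) hq (by simp) (by simp)).mono'
      (by fun_prop) ?_
    filter_upwards [ae_restrict_mem measurableSet_Ioi] with t (ht : 0 < t)
    rw [norm_of_nonneg (hk_pos t ht).le]
    linarith [hk_le (S := 1) (S' := -1) le_rfl le_rfl (by norm_num) ht, hk_pos t ht]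
  have hk_integral : 0 < ∫ t in Ioi 0, k t := by
    rw [setIntegral_pos_iff_support_of_nonneg_ae _ hk_int]
    · have hsupp : Ioi 0 ⊆ Function.support k := fun t ht => (hk_pos t ht).ne'
      rw [inter_eq_right.2 hsupp]
      simp
    · filter_upwards [ae_restrict_mem measurableSet_Ioi] with t ht using (hk_pos t ht).le
  refine ⟨(∫ t in Ioi 0, k t) / (2 * Gamma q), by positivity, fun S hS S' hS' h => ?_⟩
  rw [oddSineIntegral_sub hq hS hS', div_mul_eq_mul_div, ← integral_mul_const]
  exact div_le_div_of_nonneg_right (setIntegral_mono_on (hk_int.mul_const _)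
    (integrableOn_rpow_mul_arctanKernel_sub hq hS hS') measurableSet_Ioi
    fun t ht => hk_le hS.2 hS'.1 h ht) (by positivity)

theorem continuousOn_Gamma_Ioi : ContinuousOn Gamma (Ioi 0) := fun p (hp : 0 < p) =>
  (differentiableAt_Gamma fun m => by linarith [m.cast_nonneg (α := ℝ)]).continuousAt
    |>.continuousWithinAt

theorem exists_oddSineIntegral_sub_le_add {a b σ : ℝ} (ha : 0 < a) (hσ : 0 ≤ σ) :
    ∃ K, 0 ≤ K ∧ ∀ p ∈ Icc a b, ∀ r, 0 < r → ∀ S ∈ Icc (-1 : ℝ) 1, ∀ S' ∈ Icc (-1 : ℝ) 1, S' ≤ S →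
      oddSineIntegral p S - oddSineIntegral p S'
        ≤ K * (r ^ p + r ^ (-σ) * (oddSineIntegral (p + σ) S - oddSineIntegral (p + σ) S')) := by
  have hpos : ∀ p ∈ Icc a b, 0 < p := fun p hp => ha.trans_le hp.1
  have hΓ : ContinuousOn Gamma (Icc a b) := continuousOn_Gamma_Ioi.mono hpos
  have hΓ_ne : ∀ p ∈ Icc a b, Gamma p ≠ 0 := fun p hp => (Gamma_pos_of_pos (hpos p hp)).ne'
  have hΓσ : ContinuousOn (fun p => Gamma (p + σ)) (Icc a b) :=
    continuousOn_Gamma_Ioi.comp (by fun_prop) fun p hp => add_pos_of_pos_of_nonneg (hpos p hp) hσ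
  obtain ⟨K₁, hK₁⟩ := isCompact_Icc.exists_bound_of_continuousOn (E := ℝ) (s := Icc a b)
    (f := fun p => π / p / (2 * Gamma p)) <|
    (continuousOn_const.div continuousOn_id fun p hp => (hpos p hp).ne').div
      (hΓ.const_mul 2) fun p hp => mul_ne_zero two_ne_zero (hΓ_ne p hp)
  obtain ⟨K₂, hK₂⟩ := isCompact_Icc.exists_bound_of_continuousOn (hΓσ.div hΓ hΓ_ne)
  refine ⟨max |K₁| |K₂|, by positivity, fun p hp r hr S hS S' hS' h => ?_⟩
  have hD := sub_nonneg.2 (oddSineIntegral_mono (add_pos_of_pos_of_nonneg (hpos p hp) hσ) hS hS' h)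
  refine (oddSineIntegral_sub_le_add (hpos p hp) hσ hr hS hS' h).trans ?_
  rw [mul_add]
  gcongr
  · exact (le_norm_self _).trans
      ((hK₁ p hp).trans ((le_abs_self _).trans (le_max_left _ _)))
  · exact (le_norm_self _).trans
      ((hK₂ p hp).trans ((le_abs_self _).trans (le_max_right _ _)))

theorem exists_oddSineIntegral_sub_le_rpow {a b : ℝ} (ha : 0 < a) (hb : b < 1) :
    ∃ K, 0 ≤ K ∧ ∀ p ∈ Icc a b, ∀ S ∈ Icc (-1 : ℝ) 1, ∀ S' ∈ Icc (-1 : ℝ) 1, S' ≤ S →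
      oddSineIntegral p S - oddSineIntegral p S' ≤ K * (S - S') ^ p := by
  have hpos : ∀ p ∈ Icc a b, 0 < p := fun p hp => ha.trans_le hp.1
  have hlt : ∀ p ∈ Icc a b, p < 1 := fun p hp => hp.2.trans_lt hb
  obtain ⟨K, hK⟩ := isCompact_Icc.exists_bound_of_continuousOn (E := ℝ) (s := Icc a b)
    (f := fun p => (π / p + 1 / (1 - p)) / (2 * Gamma p)) <|
    ((continuousOn_const.div continuousOn_id fun p hp => (hpos p hp).ne').add
      (continuousOn_const.div (by fun_prop) fun p hp => (sub_pos.2 (hlt p hp)).ne')).div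
      ((continuousOn_Gamma_Ioi.mono hpos).const_mul 2)
      fun p hp => mul_ne_zero two_ne_zero (Gamma_pos_of_pos (hpos p hp)).ne'
  refine ⟨|K|, abs_nonneg K, fun p hp S hS S' hS' h => ?_⟩
  refine (oddSineIntegral_sub_le_rpow (hpos p hp) (hlt p hp) hS hS' h).trans ?_
  exact mul_le_mul_of_nonneg_right ((le_norm_self _).trans ((hK p hp).trans
    (le_abs_self K))) (rpow_nonneg (sub_nonneg.2 h) _)

end Increments

section Extension

open scoped NNReal

theorem exists_holderWith_eqOn {X : Type*} [PseudoMetricSpace X] {f : X → ℝ} {Ω : Set X}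
    {C r : ℝ≥0} (hr0 : 0 < r) (hr1 : r ≤ 1) (hf : HolderOnWith C r f Ω) :
    ∃ g, HolderWith C r g ∧ EqOn f g Ω := by
  have hr0' : (0 : ℝ) < r := hr0
  have hr1' : (r : ℝ) ≤ 1 := hr1
  let e := Metric.Snowflaking.ofSnowflaking (X := X) (hα₀ := hr0') (hα₁ := hr1')
  obtain ⟨g, hg, hfg⟩ := LipschitzOnWith.extend_real (f := f ∘ e) (s := e ⁻¹' Ω) (K := C)
    fun x hx y hy => hf _ hx _ hy
  refine ⟨g ∘ e.symm, fun x y => hg (e.symm x) (e.symm y), fun x hx => ?_⟩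
  exact hfg (x := e.symm x) hx

theorem isHolder_univ_of_holderWith {f : ℝ → ℝ} {C β : ℝ≥0} {M : ℝ} (hβ0 : 0 < β) (hβ1 : β < 1)
    (hM : ∀ x, |f x| ≤ M) (hf : HolderWith C β f) : IsHolder β univ f := by
  have hfloor : ⌊(β : ℝ)⌋₊ = 0 := Nat.floor_eq_zero.2 hβ1
  refine ⟨?_, fun k hk => ?_, C, ?_⟩
  · simpa [hfloor] using hf.continuous hβ0
  · obtain rfl : k = 0 := by omega
    simpa using ⟨M, hM⟩
  · simpa [hfloor] using hf.holderOnWith univ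

theorem exists_isHolder_comp_eq {X : Type*} {u g : X → ℝ} {β C M : ℝ} (hβ0 : 0 < β) (hβ1 : β < 1)
    (hM : ∀ x, |g x| ≤ M) (h : ∀ x y, |g x - g y| ≤ C * |u x - u y| ^ β) :
    ∃ f : ℝ → ℝ, IsHolder β univ f ∧ ∀ x, f (u x) = g x := by
  lift β to ℝ≥0 using hβ0.le
  have hfactor : g.FactorsThrough u := fun x y hxy => by
    have := h x y
    rw [hxy, sub_self, abs_zero, Real.zero_rpow hβ0.ne', mul_zero] at this
    exact sub_eq_zero.1 (abs_nonpos_iff.1 this)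
  have hext : HolderOnWith C.toNNReal (β : ℝ).toNNReal (u.extend g 0) (range u) :=
    holderOnWith_of_abs_sub_le hβ0.le <| by
      rintro _ ⟨x, rfl⟩ _ ⟨y, rfl⟩
      rw [hfactor.extend_apply, hfactor.extend_apply]
      exact h x y
  rw [Real.toNNReal_coe] at hext
  have hβ0' : 0 < β := hβ0
  have hβ1' : β < 1 := hβ1
  obtain ⟨f, hf, hfg⟩ := exists_holderWith_eqOn hβ0' hβ1'.le hext
  have hclamp : LipschitzWith 1 fun t : ℝ => max (-M) (min M t) :=
    (LipschitzWith.id.const_min M).const_max (-M)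
  refine ⟨fun t => max (-M) (min M (f t)), isHolder_univ_of_holderWith (M := |M|) hβ0' hβ1'
    (fun t => abs_le.2 ?_)
    (by simpa [Function.comp_def] using hclamp.holderWith.comp hf), fun x => ?_⟩
  · exact ⟨(neg_le_neg (le_abs_self M)).trans (le_max_left _ _),
      max_le (neg_le_abs M) ((min_le_left _ _).trans (le_abs_self M))⟩
  · have hx := abs_le.1 (hM x)
    simp only [← hfg (mem_range_self x), hfactor.extend_apply, min_eq_right hx.2,
      max_eq_right hx.1]

end Extension

section Superposition

open Real

/-- The exponents `h / (j + 1)`, decreasing to `0`, by which the summands of `oddSeries` are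
smoother than their superposition. -/
noncomputable def excess (h : ℝ) (j : ℕ) : ℝ := h / (j + 1)

theorem excess_pos {h : ℝ} (hh : 0 < h) (j : ℕ) : 0 < excess h j := div_pos hh (by positivity)

theorem excess_le {h : ℝ} (hh : 0 < h) (j : ℕ) : excess h j ≤ h :=
  div_le_self hh.le (le_add_of_nonneg_left j.cast_nonneg)

theorem exists_excess_lt (h : ℝ) {δ : ℝ} (hδ : 0 < δ) : ∃ j, excess h j < δ := by
  obtain ⟨j, hj⟩ := exists_nat_gt (h / δ)
  refine ⟨j, (div_lt_iff₀ (by positivity)).2 ?_⟩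
  linarith [(div_lt_iff₀' hδ).1 hj]

/-- Positive weights for which the double series `∑ weight h j * (2 i + 1) ^ (-1 - excess h j)`
converges. -/
noncomputable def weight (h : ℝ) (j : ℕ) : ℝ :=
  (1 / 2) ^ j / (1 + ∑' i : ℕ, (2 * i + 1 : ℝ) ^ (-1 - excess h j))

theorem weight_pos (h : ℝ) (j : ℕ) : 0 < weight h j := by
  unfold weight
  positivity

theorem weight_mul_one_add_tsum (h : ℝ) (j : ℕ) :
    weight h j * (1 + ∑' i : ℕ, (2 * i + 1 : ℝ) ^ (-1 - excess h j)) = (1 / 2) ^ j :=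
  div_mul_cancel₀ _ (by positivity)

theorem summable_weight (h : ℝ) : Summable (weight h) := by
  refine summable_geometric_two.of_nonneg_of_le (fun j => (weight_pos h j).le) fun j => ?_
  rw [← weight_mul_one_add_tsum h j]
  exact le_mul_of_one_le_right (weight_pos h j).le (le_add_of_nonneg_right (by positivity))

/-- The amplitudes of `oddSeries`; the pair `(j, i)` indexes the `i`-th harmonic of the `j`-th
summand. -/
noncomputable def oddCoeff (h θ : ℝ) (q : ℕ × ℕ) : ℝ :=
  weight h q.1 * (2 * q.2 + 1 : ℝ) ^ (-1 - θ - excess h q.1)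

theorem oddCoeff_nonneg (h θ : ℝ) (q : ℕ × ℕ) : 0 ≤ oddCoeff h θ q :=
  mul_nonneg (weight_pos h q.1).le (by positivity)

theorem summable_oddCoeff_zero {h : ℝ} (hh : 0 < h) : Summable (oddCoeff h 0) := by
  have hsum (j : ℕ) : Summable fun i : ℕ => (2 * i + 1 : ℝ) ^ (-1 - excess h j) :=
    summable_odd_rpow (by linarith [excess_pos hh j])
  refine (summable_prod_of_nonneg (oddCoeff_nonneg h 0)).2 ⟨fun j => ?_, ?_⟩
  · simpa only [oddCoeff, sub_zero] using (hsum j).mul_left (weight h j)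
  · refine summable_geometric_two.of_nonneg_of_le
      (fun j => tsum_nonneg fun i => oddCoeff_nonneg h 0 (j, i)) fun j => ?_
    simp only [oddCoeff, sub_zero]
    rw [tsum_mul_left, ← weight_mul_one_add_tsum h j]
    exact mul_le_mul_of_nonneg_left (le_add_of_nonneg_left zero_le_one) (weight_pos h j).le

theorem summable_oddCoeff {h θ : ℝ} (hh : 0 < h) (hθ : 0 ≤ θ) : Summable (oddCoeff h θ) := by
  refine (summable_oddCoeff_zero hh).of_nonneg_of_le (oddCoeff_nonneg h θ) fun q => ?_
  exact mul_le_mul_of_nonneg_left (rpow_le_rpow_of_exponent_le (by simp) (by linarith))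
    (weight_pos h q.1).le

/-- The frequencies of `oddSeries`. -/
noncomputable def oddFreq (ω : ℝ) (q : ℕ × ℕ) : ℝ := ω * (2 * q.2 + 1)

theorem oddFreq_pos {ω : ℝ} (hω : 0 < ω) (q : ℕ × ℕ) : 0 < oddFreq ω q :=
  mul_pos hω (by positivity)

theorem oddCoeff_mul_oddFreq_rpow {ω : ℝ} (hω : 0 < ω) (h θ σ : ℝ) (q : ℕ × ℕ) :
    oddCoeff h (θ + σ) q * oddFreq ω q ^ σ = ω ^ σ * oddCoeff h θ q := by
  have hpos : (0 : ℝ) < 2 * q.2 + 1 := by positivity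
  have hexp : (2 * q.2 + 1 : ℝ) ^ (-1 - (θ + σ) - excess h q.1) * (2 * q.2 + 1 : ℝ) ^ σ
      = (2 * q.2 + 1 : ℝ) ^ (-1 - θ - excess h q.1) := by
    rw [← rpow_add hpos]
    ring_nf
  rw [oddFreq, mul_rpow hω.le hpos.le, oddCoeff, oddCoeff, ← hexp]
  ring

theorem summable_oddCoeff_mul_oddFreq_rpow {ω h θ σ : ℝ} (hω : 0 < ω) (hh : 0 < h) (hθ : 0 ≤ θ) :
    Summable fun q => oddCoeff h (θ + σ) q * oddFreq ω q ^ σ := by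
  simp only [oddCoeff_mul_oddFreq_rpow hω]
  exact (summable_oddCoeff hh hθ).mul_left _

/-- The solution: a superposition of the functions `∑ (2 i + 1) ^ (-1 - γ - η) sin ((2 i + 1) ω x)`
over exponents `η` decreasing to `0`. Each of them is slightly smoother than `C ^ γ`, while their
superposition is not. -/
noncomputable def oddSeries (ω h γ : ℝ) : ℝ → ℝ := sineSeries (oddCoeff h γ) (oddFreq ω) 0

variable {ω h γ : ℝ}

theorem isHolder_oddSeries (hω : 0 < ω) (hh : 0 < h) (hγ : 0 ≤ γ) :
    IsHolder γ univ (oddSeries ω h γ) := by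
  refine isHolder_sineSeries (fun q => (oddFreq_pos hω q).le) (summable_oddCoeff hh hγ) hγ ?_
  simpa using summable_oddCoeff_mul_oddFreq_rpow (σ := γ) hω hh le_rfl

theorem periodic_oddSeries {L : ℝ} (hL : L ≠ 0) (h γ : ℝ) :
    Function.Periodic (oddSeries (π / L) h γ) (2 * L) := fun x => by
  refine tsum_congr fun q => ?_
  have hshift : oddFreq (π / L) q * (x + 2 * L) + 0
      = oddFreq (π / L) q * x + 0 + (2 * q.2 + 1 : ℕ) * (2 * π) := by
    rw [oddFreq]
    push_cast
    field_simp
    ring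
  rw [hshift, sin_add_nat_mul_two_pi]

theorem hasFracLaplacian_oddSeries {s θ : ℝ} (hs0 : 0 < s) (hs1 : s < 1) (hω : 0 < ω) (hh : 0 < h)
    (hθ : 0 ≤ θ) (x : ℝ) :
    HasFracLaplacian s (oddSeries ω h (θ + 2 * s)) x
      (fracLaplacianConst s * (∫ t : ℝ, (1 - cos t) / |t| ^ (1 + 2 * s)) * ω ^ (2 * s) *
        oddSeries ω h θ x) := by
  have hseries : sineSeries (fun q => oddCoeff h (θ + 2 * s) q * oddFreq ω q ^ (2 * s))
      (oddFreq ω) 0 x = ω ^ (2 * s) * oddSeries ω h θ x := by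
    simp only [oddSeries, sineSeries, oddCoeff_mul_oddFreq_rpow hω, mul_assoc, tsum_mul_left]
  rw [mul_assoc, ← hseries]
  exact hasFracLaplacian_sineSeries hs0 hs1 (fun q => (oddFreq_pos hω q).le)
    (summable_oddCoeff hh (by positivity)) (summable_oddCoeff_mul_oddFreq_rpow hω hh hθ) x

theorem exists_isHolder_hasFracLaplacian {s β θ C : ℝ} (hs0 : 0 < s) (hs1 : s < 1) (hβ0 : 0 < β)
    (hβ1 : β < 1) (hω : 0 < ω) (hh : 0 < h) (hθ : 0 ≤ θ)
    (H : ∀ x y, |oddSeries ω h θ x - oddSeries ω h θ y|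
      ≤ C * |oddSeries ω h (θ + 2 * s) x - oddSeries ω h (θ + 2 * s) y| ^ β) :
    ∃ f : ℝ → ℝ, IsHolder β univ f ∧
      ∀ x, HasFracLaplacian s (oddSeries ω h (θ + 2 * s)) x (f (oddSeries ω h (θ + 2 * s) x)) := by
  set A := fracLaplacianConst s * (∫ t : ℝ, (1 - cos t) / |t| ^ (1 + 2 * s)) * ω ^ (2 * s)
  obtain ⟨f, hf, hfu⟩ := exists_isHolder_comp_eq (u := oddSeries ω h (θ + 2 * s))
    (g := fun x => A * oddSeries ω h θ x) (C := |A| * C) hβ0 hβ1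
    (fun x => (abs_mul A _).le.trans <|
      mul_le_mul_of_nonneg_left (abs_sineSeries_le (summable_oddCoeff hh hθ) x) (abs_nonneg A))
    fun x y => by
      rw [← mul_sub, abs_mul, mul_assoc]
      exact mul_le_mul_of_nonneg_left (H x y) (abs_nonneg A)
  refine ⟨f, hf, fun x => ?_⟩
  rw [hfu]
  exact hasFracLaplacian_oddSeries hs0 hs1 hω hh hθ x

end Superposition

section Comparison

open Real

/-- The value of `oddSeries ω h θ` at `x` as a function of `S = sin (ω x)`. -/
noncomputable def oddSineSum (h θ S : ℝ) : ℝ :=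
  ∑' j, weight h j * oddSineIntegral (θ + excess h j) S

variable {h γ θ : ℝ}

theorem hasSum_weight_mul_oddSineIntegral (hh : 0 < h) (hθ : 0 ≤ θ) (ω x : ℝ) :
    HasSum (fun j => weight h j * oddSineIntegral (θ + excess h j) (sin (ω * x)))
      (oddSeries ω h θ x) := by
  refine (summable_mul_sin (summable_oddCoeff hh hθ) _).hasSum.prod_fiberwise fun j => ?_
  refine ((hasSum_odd_rpow_mul_sin (by linarith [excess_pos hh j]) (ω * x)).mul_left
    (weight h j)).congr_fun fun i => ?_
  rw [oddCoeff, oddFreq]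
  ring_nf

theorem oddSeries_eq_oddSineSum (hh : 0 < h) (hθ : 0 ≤ θ) (ω x : ℝ) :
    oddSeries ω h θ x = oddSineSum h θ (sin (ω * x)) :=
  (hasSum_weight_mul_oddSineIntegral hh hθ ω x).tsum_eq.symm

theorem hasSum_oddSineSum_sub (hh : 0 < h) (hθ : 0 ≤ θ) {S S' : ℝ} (hS : S ∈ Icc (-1) 1)
    (hS' : S' ∈ Icc (-1) 1) :
    HasSum (fun j => weight h j *
        (oddSineIntegral (θ + excess h j) S - oddSineIntegral (θ + excess h j) S'))
      (oddSineSum h θ S - oddSineSum h θ S') := by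
  have hsum {S : ℝ} (hS : S ∈ Icc (-1) 1) :
      Summable fun j => weight h j * oddSineIntegral (θ + excess h j) S := by
    simpa [sin_arcsin hS.1 hS.2] using
      (hasSum_weight_mul_oddSineIntegral hh hθ 1 (arcsin S)).summable
  simp only [mul_sub]
  exact (hsum hS).hasSum.sub (hsum hS').hasSum

theorem oddSineSum_sub_le_tsum (hh : 0 < h) (hθ : 0 ≤ θ) {S S' : ℝ} (hS : S ∈ Icc (-1) 1)
    (hS' : S' ∈ Icc (-1) 1) :
    oddSineSum h θ S - oddSineSum h θ S' ≤ 2 * ∑' q, |oddCoeff h θ q| := by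
  have hle {S : ℝ} (hS : S ∈ Icc (-1) 1) : |oddSineSum h θ S| ≤ ∑' q, |oddCoeff h θ q| := by
    have h1 := oddSeries_eq_oddSineSum hh hθ 1 (arcsin S)
    rw [one_mul, sin_arcsin hS.1 hS.2] at h1
    exact h1 ▸ abs_sineSeries_le (summable_oddCoeff hh hθ) (arcsin S)
  linarith [(abs_le.1 (hle hS)).2, (abs_le.1 (hle hS')).1]

theorem weight_mul_oddSineIntegral_sub_nonneg (hh : 0 < h) (hθ : 0 ≤ θ) {S S' : ℝ}
    (hS : S ∈ Icc (-1) 1) (hS' : S' ∈ Icc (-1) 1) (hle : S' ≤ S) (j : ℕ) :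
    0 ≤ weight h j *
      (oddSineIntegral (θ + excess h j) S - oddSineIntegral (θ + excess h j) S') :=
  mul_nonneg (weight_pos h j).le
    (sub_nonneg.2 (oddSineIntegral_mono (by linarith [excess_pos hh j]) hS hS' hle))

theorem monotoneOn_oddSineSum (hh : 0 < h) (hθ : 0 ≤ θ) :
    MonotoneOn (oddSineSum h θ) (Icc (-1) 1) := fun _ hS' _ hS hle =>
  sub_nonneg.1 ((hasSum_oddSineSum_sub hh hθ hS hS').nonneg
    (weight_mul_oddSineIntegral_sub_nonneg hh hθ hS hS' hle))

theorem exists_mul_le_oddSineSum_sub (hh : 0 < h) (hθ : 0 ≤ θ) :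
    ∃ c, 0 < c ∧ ∀ S ∈ Icc (-1 : ℝ) 1, ∀ S' ∈ Icc (-1 : ℝ) 1, S' ≤ S →
      c * (S - S') ≤ oddSineSum h θ S - oddSineSum h θ S' := by
  have hpos : 0 < θ + excess h 0 := by linarith [excess_pos hh 0]
  obtain ⟨c, hc, hlow⟩ := exists_mul_le_oddSineIntegral_sub hpos
  refine ⟨weight h 0 * c, mul_pos (weight_pos h 0) hc, fun S hS S' hS' hle => ?_⟩
  rw [mul_assoc]
  exact (mul_le_mul_of_nonneg_left (hlow S hS S' hS' hle) (weight_pos h 0).le).trans <|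
    le_hasSum (hasSum_oddSineSum_sub hh hθ hS hS') 0 fun j _ =>
      weight_mul_oddSineIntegral_sub_nonneg hh hθ hS hS' hle j

theorem oddSineSum_sub_le_add (hh : 0 < h) (hθ : 0 ≤ θ) (hγ : 0 ≤ γ) {A B S S' : ℝ}
    (hS : S ∈ Icc (-1) 1) (hS' : S' ∈ Icc (-1) 1)
    (H : ∀ j, oddSineIntegral (θ + excess h j) S - oddSineIntegral (θ + excess h j) S'
      ≤ A + B * (oddSineIntegral (γ + excess h j) S - oddSineIntegral (γ + excess h j) S')) :
    oddSineSum h θ S - oddSineSum h θ S'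
      ≤ A * ∑' j, weight h j + B * (oddSineSum h γ S - oddSineSum h γ S') := by
  refine hasSum_le (fun j => ?_) (hasSum_oddSineSum_sub hh hθ hS hS')
    (((summable_weight h).hasSum.mul_left A).add
      ((hasSum_oddSineSum_sub hh hγ hS hS').mul_left B))
  linarith [mul_le_mul_of_nonneg_left (H j) (weight_pos h j).le]

theorem exists_oddSineSum_sub_le_rpow_of_mul {β : ℝ} (hh : 0 < h) (hγ : 0 < γ) (hβ0 : 0 < β)
    (hβ1 : β ≤ 1) :
    ∃ C, ∀ S ∈ Icc (-1 : ℝ) 1, ∀ S' ∈ Icc (-1 : ℝ) 1, S' ≤ S →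
      oddSineSum h (γ * β) S - oddSineSum h (γ * β) S'
        ≤ C * (oddSineSum h γ S - oddSineSum h γ S') ^ β := by
  have hσ : 0 ≤ γ * (1 - β) := mul_nonneg hγ.le (sub_nonneg.2 hβ1)
  obtain ⟨K, hK0, hK⟩ :=
    exists_oddSineIntegral_sub_le_add (b := γ * β + h) (mul_pos hγ hβ0) hσ
  obtain ⟨c, hc, hlow⟩ := exists_mul_le_oddSineSum_sub hh hγ.le
  set R := (2 * ∑' q, |oddCoeff h γ q|) ^ (1 / γ)
  refine ⟨K * (1 + R ^ h) * ∑' j, weight h j + K, fun S hS S' hS' hle => ?_⟩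
  obtain rfl | hlt := hle.eq_or_lt
  · simp [hβ0.ne']
  set D := oddSineSum h γ S - oddSineSum h γ S'
  have hD : 0 < D := (mul_pos hc (sub_pos.2 hlt)).trans_le (hlow S hS S' hS' hle)
  -- This choice of `r` balances the two terms in `exists_oddSineIntegral_sub_le_add`.
  set r := D ^ (1 / γ)
  have hr : 0 < r := rpow_pos_of_pos hD _
  have hrR : r ≤ R := rpow_le_rpow hD.le (oddSineSum_sub_le_tsum hh hγ.le hS hS') (by positivity)
  have hnear : r ^ (γ * β) = D ^ β := by
    rw [← rpow_mul hD.le, ← mul_assoc, one_div_mul_cancel hγ.ne', one_mul]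
  have hfar : r ^ (-(γ * (1 - β))) * D = D ^ β := by
    rw [← rpow_mul hD.le, ← rpow_add_one hD.ne']
    congr 1
    field_simp
    ring
  refine (oddSineSum_sub_le_add (A := K * (1 + R ^ h) * D ^ β) (B := K * r ^ (-(γ * (1 - β))))
    hh (by positivity) hγ.le hS hS' fun j => ?_).trans (le_of_eq ?_)
  · have hη := excess_pos hh j
    have hmem : γ * β + excess h j ∈ Icc (γ * β) (γ * β + h) :=
      ⟨by linarith, by linarith [excess_le hh j]⟩
    have hrη : r ^ excess h j ≤ 1 + R ^ h :=
      (rpow_le_one_add_rpow hr.le hη.le (excess_le hh j)).trans (by gcongr)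
    have hj := hK _ hmem r hr S hS S' hS' hle
    rw [show γ * β + excess h j + γ * (1 - β) = γ + excess h j by ring, rpow_add hr, hnear] at hj
    refine hj.trans ?_
    rw [mul_add, mul_assoc K (1 + _), mul_comm (1 + _), mul_assoc K]
    gcongr
  · linear_combination K * hfar

theorem exists_oddSineSum_sub_le_rpow_of_add_lt_one {β : ℝ} (hh : 0 < h) (hγ : 0 ≤ γ) (hβ : 0 < β)
    (hβh : β + h < 1) :
    ∃ C, ∀ S ∈ Icc (-1 : ℝ) 1, ∀ S' ∈ Icc (-1 : ℝ) 1, S' ≤ S →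
      oddSineSum h β S - oddSineSum h β S'
        ≤ C * (oddSineSum h γ S - oddSineSum h γ S') ^ β := by
  obtain ⟨K, hK0, hK⟩ := exists_oddSineIntegral_sub_le_rpow hβ hβh
  obtain ⟨c, hc, hlow⟩ := exists_mul_le_oddSineSum_sub hh hγ
  refine ⟨K * (1 + 2 ^ h) * (∑' j, weight h j) * (1 / c) ^ β, fun S hS S' hS' hle => ?_⟩
  have hd : 0 ≤ S - S' := sub_nonneg.2 hle
  have hd2 : S - S' ≤ 2 := by linarith [hS.2, hS'.1]
  have hW : 0 ≤ ∑' j, weight h j := tsum_nonneg fun j => (weight_pos h j).le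
  have hupper : oddSineSum h β S - oddSineSum h β S'
      ≤ K * (1 + 2 ^ h) * (S - S') ^ β * ∑' j, weight h j := by
    refine (oddSineSum_sub_le_add (A := K * (1 + 2 ^ h) * (S - S') ^ β) (B := 0) hh hβ.le hβ.le
      hS hS' fun j => ?_).trans_eq (by rw [zero_mul, add_zero])
    have hη := excess_pos hh j
    have hmem : β + excess h j ∈ Icc β (β + h) := ⟨by linarith, by linarith [excess_le hh j]⟩
    have hdη : (S - S') ^ excess h j ≤ 1 + 2 ^ h :=
      (rpow_le_one_add_rpow hd hη.le (excess_le hh j)).trans (by gcongr)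
    refine (hK _ hmem S hS S' hS' hle).trans ?_
    rw [rpow_add_of_nonneg hd hβ.le hη.le, zero_mul, add_zero, mul_right_comm, ← mul_assoc]
    gcongr
  have hlower : (S - S') ^ β ≤ (1 / c) ^ β * (oddSineSum h γ S - oddSineSum h γ S') ^ β := by
    have hmono := sub_nonneg.2 (monotoneOn_oddSineSum hh hγ hS' hS hle)
    rw [← mul_rpow (by positivity) hmono]
    refine rpow_le_rpow hd ?_ hβ.le
    rw [one_div_mul_eq_div, le_div_iff₀' hc]
    exact hlow S hS S' hS' hle
  calc oddSineSum h β S - oddSineSum h β S'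
      ≤ K * (1 + 2 ^ h) * (∑' j, weight h j) * (S - S') ^ β :=
        hupper.trans_eq (mul_right_comm _ _ _)
    _ ≤ _ := by
        rw [mul_assoc _ (_ ^ β)]
        exact mul_le_mul_of_nonneg_left hlower (by positivity)

theorem abs_sub_le_of_monotoneOn {f g : ℝ → ℝ} {Ω : Set ℝ} {C β : ℝ} (hf : MonotoneOn f Ω)
    (hg : MonotoneOn g Ω)
    (H : ∀ S ∈ Ω, ∀ S' ∈ Ω, S' ≤ S → f S - f S' ≤ C * (g S - g S') ^ β) :
    ∀ S ∈ Ω, ∀ S' ∈ Ω, |f S - f S'| ≤ C * |g S - g S'| ^ β := by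
  intro S hS S' hS'
  wlog hle : S' ≤ S generalizing S S'
  · rw [abs_sub_comm, abs_sub_comm (g S)]
    exact this S' hS' S hS (le_of_not_ge hle)
  rw [abs_of_nonneg (sub_nonneg.2 (hf hS' hS hle)), abs_of_nonneg (sub_nonneg.2 (hg hS' hS hle))]
  exact H S hS S' hS' hle

theorem abs_oddSeries_sub_le {C β : ℝ} (hh : 0 < h) (hθ : 0 ≤ θ) (hγ : 0 ≤ γ)
    (H : ∀ S ∈ Icc (-1 : ℝ) 1, ∀ S' ∈ Icc (-1 : ℝ) 1, S' ≤ S →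
      oddSineSum h θ S - oddSineSum h θ S' ≤ C * (oddSineSum h γ S - oddSineSum h γ S') ^ β)
    (ω x y : ℝ) :
    |oddSeries ω h θ x - oddSeries ω h θ y|
      ≤ C * |oddSeries ω h γ x - oddSeries ω h γ y| ^ β := by
  simp only [oddSeries_eq_oddSineSum hh hθ, oddSeries_eq_oddSineSum hh hγ]
  exact abs_sub_le_of_monotoneOn (monotoneOn_oddSineSum hh hθ) (monotoneOn_oddSineSum hh hγ) H
    _ (sin_mem_Icc _) _ (sin_mem_Icc _)

end Comparison

section Sharpness

open Real

variable {ω h γ : ℝ}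

theorem le_sum_oddCoeff (hh : 0 < h) (hγ : 0 ≤ γ) (j : ℕ) {N : ℕ} (hN : 0 < N) :
    weight h j * (4 ^ (-1 - γ - excess h j) * (N : ℝ) ^ (-γ - excess h j))
      ≤ ∑ q ∈ {j} ×ˢ Finset.Ico N (2 * N), oddCoeff h γ q := by
  have hN' : (0 : ℝ) < N := mod_cast hN
  have hterm : ∀ i ∈ Finset.Ico N (2 * N),
      (4 * N : ℝ) ^ (-1 - γ - excess h j) ≤ (2 * i + 1 : ℝ) ^ (-1 - γ - excess h j) := by
    intro i hi
    have hi' : (i : ℝ) + 1 ≤ 2 * N := mod_cast (Finset.mem_Ico.1 hi).2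
    exact rpow_le_rpow_of_nonpos (by positivity) (by linarith) (by linarith [excess_pos hh j])
  have hcard : (Finset.Ico N (2 * N)).card = N := by
    rw [Nat.card_Ico, two_mul, Nat.add_sub_cancel]
  have hpow : 4 ^ (-1 - γ - excess h j) * (N : ℝ) ^ (-γ - excess h j)
      = N * (4 * N : ℝ) ^ (-1 - γ - excess h j) := by
    rw [show -γ - excess h j = -1 - γ - excess h j + 1 by ring, rpow_add_one hN'.ne',
      mul_rpow (by norm_num) hN'.le]
    ring
  rw [Finset.sum_product, Finset.sum_singleton]
  simp only [oddCoeff]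
  rw [← Finset.mul_sum, hpow]
  refine mul_le_mul_of_nonneg_left ?_ (weight_pos h j).le
  simpa [hcard] using Finset.card_nsmul_le_sum _ _ _ hterm

theorem oddFreq_mul_mem_Icc (hω : 0 < ω) (j : ℕ) {N i : ℕ} (hi : i ∈ Finset.Ico N (2 * N)) :
    oddFreq ω (j, i) * (1 / (2 * N * ω)) ∈ Icc 1 π := by
  obtain ⟨hNi, hiN⟩ := Finset.mem_Ico.1 hi
  have hN : (0 : ℝ) < N := mod_cast (by lia : 0 < N)
  have hNi' : (N : ℝ) ≤ i := mod_cast hNi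
  have hiN' : (i : ℝ) + 1 ≤ 2 * N := mod_cast hiN
  have hval : oddFreq ω (j, i) * (1 / (2 * N * ω)) = (2 * i + 1) / (2 * N) := by
    rw [oddFreq]
    field_simp
  rw [hval, mem_Icc, le_div_iff₀ (by positivity), div_le_iff₀ (by positivity)]
  exact ⟨by linarith, by nlinarith [pi_gt_three]⟩

theorem not_isHolder_oddSeries {ε ρ : ℝ} (hω : 0 < ω) (hh : 0 < h) (hγ : 0 ≤ γ) (hε : 0 < ε)
    (hρ : 0 < ρ) : ¬ IsHolder (γ + ε) (Icc (-ρ) ρ) (oddSeries ω h γ) := by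
  intro H
  obtain ⟨δ, C, hδ, hC⟩ := exists_sum_le_of_isHolder (oddFreq_pos hω) (oddCoeff_nonneg h γ)
    (summable_oddCoeff hh hγ) hγ
    (by simpa using summable_oddCoeff_mul_oddFreq_rpow (σ := γ) hω hh le_rfl) hε hρ H
  obtain ⟨j, hj⟩ := exists_excess_lt h hδ
  have hη := sub_pos.2 hj
  -- Test the bound at `x = 1 / (2 N ω)` on the frequencies between `2 N ω` and `4 N ω`.
  have hbound : ∀ᶠ N : ℕ in atTop, weight h j * (4 : ℝ) ^ (-1 - γ - excess h j)
      ≤ C * (1 / (2 * ω)) ^ (γ + δ) * (N : ℝ) ^ (-(δ - excess h j)) := by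
    have hx : ∀ᶠ N : ℕ in atTop, 1 / (2 * ω) / ρ ≤ N :=
      tendsto_natCast_atTop_atTop.eventually_ge_atTop _
    filter_upwards [hx, eventually_gt_atTop 0] with N hx hN
    have hN' : (0 : ℝ) < N := mod_cast hN
    have hxN : 1 / (2 * N * ω) ∈ Ioc 0 ρ := by
      refine ⟨by positivity, ?_⟩
      rw [div_div, div_le_iff₀ (by positivity)] at hx
      rw [div_le_iff₀ (by positivity)]
      linarith
    have hsum : weight h j * (4 ^ (-1 - γ - excess h j) * (N : ℝ) ^ (-γ - excess h j))
        ≤ C * (1 / (2 * N * ω)) ^ (γ + δ) :=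
      (le_sum_oddCoeff hh hγ j hN).trans <| hC _ hxN _ fun q hq => by
        obtain ⟨hq1, hq2⟩ := Finset.mem_product.1 hq
        obtain rfl := Finset.mem_singleton.1 hq1
        exact oddFreq_mul_mem_Icc hω q.1 hq2
    have hsplit : (1 / (2 * N * ω)) ^ (γ + δ) = (1 / (2 * ω)) ^ (γ + δ)
        * ((N : ℝ) ^ (-(δ - excess h j)) * (N : ℝ) ^ (-γ - excess h j)) := by
      rw [← rpow_add hN', show -(δ - excess h j) + (-γ - excess h j) = -(γ + δ) by ring,
        rpow_neg hN'.le, ← inv_rpow hN'.le, ← mul_rpow (by positivity) (by positivity)]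
      congr 1
      field_simp
    refine le_of_mul_le_mul_right ?_ (rpow_pos_of_pos hN' (-γ - excess h j))
    rw [hsplit] at hsum
    linarith
  have hlim := (tendsto_rpow_neg_atTop hη).comp (tendsto_natCast_atTop_atTop (R := ℝ))
  have hle := ge_of_tendsto (hlim.const_mul (C * (1 / (2 * ω)) ^ (γ + δ))) hbound
  rw [mul_zero] at hle
  exact hle.not_gt (mul_pos (weight_pos h j) (by positivity))

end Sharpness

theorem theorem1p2_general (s β L : ℝ) (hs0 : 0 < s) (hs1 : s < 1) (hβ0 : 0 < β) (hβ1 : β < 1)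
    (hL : 0 < L) {γ : ℝ} (hγ : γ = 2 * s / (1 - β) ∨ γ = 2 * s + β) :
    ∃ u : ℝ → ℝ, IsHolder γ univ u ∧ Function.Periodic u (2 * L) ∧
      (∃ f : ℝ → ℝ, IsHolder β univ f ∧ ∀ x : ℝ, HasFracLaplacian s u x (f (u x))) ∧
      ∀ ε ρ : ℝ, 0 < ε → 0 < ρ → ¬ IsHolder (γ + ε) (Icc (-ρ) ρ) u := by
  have h1β : 0 < 1 - β := sub_pos.2 hβ1
  have hω : 0 < Real.pi / L := by positivity
  have hh : 0 < (1 - β) / 2 := by positivity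
  have hγ0 : 0 < γ := by rcases hγ with rfl | rfl <;> positivity
  obtain ⟨θ, C, hθ, rfl, hC⟩ : ∃ θ C : ℝ, 0 ≤ θ ∧ γ = θ + 2 * s ∧
      ∀ S ∈ Icc (-1 : ℝ) 1, ∀ S' ∈ Icc (-1 : ℝ) 1, S' ≤ S →
        oddSineSum ((1 - β) / 2) θ S - oddSineSum ((1 - β) / 2) θ S' ≤
          C * (oddSineSum ((1 - β) / 2) γ S - oddSineSum ((1 - β) / 2) γ S') ^ β := by
    rcases hγ with hγ | hγ
    · obtain ⟨C, hC⟩ := exists_oddSineSum_sub_le_rpow_of_mul hh hγ0 hβ0 hβ1.le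
      refine ⟨γ * β, C, by positivity, ?_, hC⟩
      rw [hγ]
      field_simp
      ring
    · obtain ⟨C, hC⟩ := exists_oddSineSum_sub_le_rpow_of_add_lt_one hh hγ0.le hβ0 (by linarith)
      exact ⟨β, C, hβ0.le, by rw [hγ, add_comm], hC⟩
  exact ⟨oddSeries (Real.pi / L) ((1 - β) / 2) (θ + 2 * s), isHolder_oddSeries hω hh hγ0.le,
    periodic_oddSeries hL.ne' _ _,
    exists_isHolder_hasFracLaplacian hs0 hs1 hβ0 hβ1 hω hh hθ
      (abs_oddSeries_sub_le hh hθ hγ0.le hC _),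
    fun _ _ hε hρ => not_isHolder_oddSeries hω hh hγ0.le hε hρ⟩

theorem theorem1p2 (s β L : ℝ) (hs0 : 0 < s) (hs1 : s < 1) (hβ0 : 0 < β) (hβ1 : β < 1)
    (hL : 0 < L) :
    (2 * s ≤ 1 - β →
      ∃ u : ℝ → ℝ, IsHolder (2 * s / (1 - β)) Set.univ u ∧
        Function.Periodic u (2 * L) ∧
        (∃ f : ℝ → ℝ, IsHolder β Set.univ f ∧ ∀ x : ℝ, HasFracLaplacian s u x (f (u x))) ∧
        ∀ ε ρ : ℝ, 0 < ε → 0 < ρ →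
          ¬ IsHolder (2 * s / (1 - β) + ε) (Set.Icc (-ρ) ρ) u) ∧
    (1 - β < 2 * s →
      ∃ u : ℝ → ℝ, IsHolder (2 * s + β) Set.univ u ∧
        Function.Periodic u (2 * L) ∧
        (∃ f : ℝ → ℝ, IsHolder β Set.univ f ∧ ∀ x : ℝ, HasFracLaplacian s u x (f (u x))) ∧
        ∀ ε ρ : ℝ, 0 < ε → 0 < ρ →
          ¬ IsHolder (2 * s + β + ε) (Set.Icc (-ρ) ρ) u) :=
  ⟨fun _ => theorem1p2_general s β L hs0 hs1 hβ0 hβ1 hL (.inl rfl),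
    fun _ => theorem1p2_general s β L hs0 hs1 hβ0 hβ1 hL (.inr rfl)⟩
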